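/- Let $V$ be a finite set with $n$ elements and let $(\mathsf{Q},\mathbf{a})$ be a seed: $\mathsf{Q}$ is an ice quiver with vertex set $V$ (a quiver without loops or directed 2-cycles, some of whose vertices are declared frozen, the others being called mutable), recorded by the skew-symmetric integer matrix $\mathsf{Q}_{ij}=\#(\text{arrows } i\to j)-\#(\text{arrows } j\to i)$, and the cluster $\mathbf{a}=(a_v)_{v\in V}$ is a family in $\mathbb{Q}(x_v : v\in V)$ that is algebraically independent over $\mathbb{Q}$ (for example the initial cluster $a_v=x_v$). The mutation of $(\mathsf{Q},\mathbf{a})$ at a mutable vertex $\ell$ has quiver $\mu_\ell(\mathsf{Q})_{ij}=-\mathsf{Q}_{ij}$ if $\ell\in\{i,j\}$ and $\mu_\ell(\mathsf{Q})_{ij}=\mathsf{Q}_{ij}+\tfrac12\left(|\mathsf{Q}_{i\ell}|\mathsf{Q}_{\ell j}+\mathsf{Q}_{i\ell}|\mathsf{Q}_{\ell j}|\right)$ otherwise, with the same frozen vertices, and cluster obtained by replacing $a_\ell$ with $\left(\prod_{\mathsf{Q}_{\ell j}>0}a_j^{\mathsf{Q}_{\ell j}}+\prod_{\mathsf{Q}_{\ell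 j}<0}a_j^{-\mathsf{Q}_{\ell j}}\right)a_\ell^{-1}$. The seeds of the cluster algebra of $(\mathsf{Q},\mathbf{a})$ are those obtained by finite sequences of mutations, and the cluster algebra $\mathcal{A}=\mathcal{A}(\mathsf{Q},\mathbf{a})$ is the subring of $\mathbb{Q}(x_v : v\in V)$ generated by all elements of the clusters of these seeds together with the inverses of the frozen variables. A cluster algebra is acyclic if one of its seeds has a quiver with no directed cycle of mutable vertices. A freezing of $\mathcal{A}$ is the cluster algebra $\mathcal{A}'$ of a seed obtained from a seed of $\mathcal{A}$ by declaring some further vertices frozen; it is a cluster localization if $\mathcal{A}\subseteq\mathcal{A}'$, and then $\operatorname{Spec}\mathcal{A}'\to\operatorname{Spec}\mathcal{A}$ is called a cluster chart. $\mathcal{A}$ is locally acyclic if $\operatorname{Spec}\mathcal{A}$ is covered by (the images of) finitely many cluster charts with $\mathcal{A}'$ acyclic. $\mathcal{A}$ has full rank if its exchange matrix $(\mathsf{Q}_{ij})_{i\text{ mutable},\,j\in V}$ is surjective as a $\mathbb{Q}$-linear map. Suppose that $\mathcal{A}$ is locally acyclic of full rank. Then the set $\operatorname{Hom}(\mathcal{A},\mathbb{C})$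 of ring homomorphisms is a smooth complex manifold and $\operatorname{Hom}(\mathcal{A},\mathbb{R})$ is a smooth ($C^\infty$) real manifold. Precisely, for $k=\mathbb{C}$ (resp. $k=\mathbb{R}$), $\operatorname{Hom}(\mathcal{A},k)$ with the topology of pointwise convergence is Hausdorff and second countable, and it carries the structure of a holomorphic (resp. $C^\infty$) manifold over $k$ of dimension $n$ for which every evaluation function $p\mapsto p(f)$, $f\in\mathcal{A}$, is holomorphic (resp. $C^\infty$), and for which the differentials of these functions separate tangent vectors at every point. -/

import Mathlib

open scoped Manifold ContDiff

namespace ClusterAlg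

/-- An ice quiver with vertex set `V`: a quiver without loops or directed 2-cycles, recorded by the
skew-symmetric integer matrix `Q i j = #(arrows i → j) - #(arrows j → i)` (which determines the
quiver), together with a set of frozen vertices. The other vertices are mutable. -/
@[ext]
structure IceQuiver (V : Type*) where
  mat : Matrix V V ℤ
  skew : ∀ i j, mat i j = - mat j i
  frozen : Finset V

section

variable {V : Type*} [Fintype V] [DecidableEq V]

/-- Mutation of an ice quiver at a vertex `k`. The integer division by `2` is exact. -/
def IceQuiver.mutate (Q : IceQuiver V) (k : V) : IceQuiver V where
  mat i j :=
    if i = k ∨ j = k then - Q.mat i j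
    else Q.mat i j + (|Q.mat i k| * Q.mat k j + Q.mat i k * |Q.mat k j|) / 2
  skew i j := by
    by_cases h : i = k ∨ j = k
    · have h' : j = k ∨ i = k := h.symm
      simp only [h, h', if_true]
      rw [Q.skew i j]
    · have h' : ¬ (j = k ∨ i = k) := fun h' => h h'.symm
      simp only [h, h', if_false]
      rw [Q.skew i j, Q.skew i k, Q.skew k j, abs_neg, abs_neg]
      have key : |Q.mat k i| * -Q.mat j k + -Q.mat k i * |Q.mat j k|
          = -(|Q.mat j k| * Q.mat k i + Q.mat j k * |Q.mat k i|) := by ring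
      have hdvd : (2 : ℤ) ∣ |Q.mat j k| * Q.mat k i + Q.mat j k * |Q.mat k i| := by
        rcases abs_choice (Q.mat j k) with h1 | h1 <;> rcases abs_choice (Q.mat k i) with h2 | h2 <;>
          rw [h1, h2]
        · exact ⟨Q.mat j k * Q.mat k i, by ring⟩
        · exact ⟨0, by ring⟩
        · exact ⟨0, by ring⟩
        · exact ⟨-(Q.mat j k * Q.mat k i), by ring⟩
      rw [key, Int.neg_ediv_of_dvd hdvd]
      ring
  frozen := Q.frozen

/-- Declare the vertices in `S` frozen (in addition to those already frozen). -/
def IceQuiver.freeze (Q : IceQuiver V) (S : Finset V) : IceQuiver V where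
  mat := Q.mat
  skew := Q.skew
  frozen := Q.frozen ∪ S

/-- There are arrows from `i` to `j` in the induced subquiver on the mutable vertices. -/
def IceQuiver.MutArrow (Q : IceQuiver V) (i j : V) : Prop :=
  i ∉ Q.frozen ∧ j ∉ Q.frozen ∧ 0 < Q.mat i j

/-- An ice quiver is acyclic if its mutable part has no directed cycle. -/
def IceQuiver.IsAcyclic (Q : IceQuiver V) : Prop :=
  ∀ i, ¬ Relation.TransGen Q.MutArrow i i

/-- The exchange matrix: rows are the mutable vertices, columns are all the vertices. -/
def IceQuiver.exchangeMatrix (Q : IceQuiver V) : Matrix {i : V // i ∉ Q.frozen} V ℚ :=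
  Matrix.of fun i j => (Q.mat i j : ℚ)

/-- Full rank: the exchange matrix is surjective as a `ℚ`-linear map. -/
def IceQuiver.FullRank (Q : IceQuiver V) : Prop :=
  Function.Surjective Q.exchangeMatrix.mulVecLin

variable (V) in
/-- The field `ℚ(x_v : v ∈ V)` of rational functions. -/
abbrev RatFun : Type _ := FractionRing (MvPolynomial V ℚ)

variable (V) in
/-- A seed: an ice quiver with a cluster, i.e. a rational function attached to each vertex. -/
@[ext]
structure Seed where
  quiver : IceQuiver V
  cluster : V → RatFun V

/-- The initial seed of an ice quiver, with cluster the variables `x_v`. -/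
noncomputable def Seed.initial (Q : IceQuiver V) : Seed V where
  quiver := Q
  cluster v := algebraMap (MvPolynomial V ℚ) (RatFun V) (MvPolynomial.X v)

/-- Mutation of a seed at a vertex `k`. -/
noncomputable def Seed.mutate (s : Seed V) (k : V) : Seed V where
  quiver := s.quiver.mutate k
  cluster := Function.update s.cluster k
    ((∏ j with 0 < s.quiver.mat k j, s.cluster j ^ (s.quiver.mat k j).toNat
      + ∏ j with s.quiver.mat k j < 0, s.cluster j ^ (- s.quiver.mat k j).toNat)
      * (s.cluster k)⁻¹)

/-- `t` is obtained from `s` by a finite sequence of mutations at mutable vertices. -/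
def Seed.MutEquiv (s t : Seed V) : Prop :=
  Relation.ReflTransGen (fun u v : Seed V => ∃ k, k ∉ u.quiver.frozen ∧ v = u.mutate k) s t

/-- The cluster algebra of a seed: the subring of `ℚ(x_v)` generated by the cluster variables (all
the elements of the clusters of all mutation equivalent seeds, frozen ones included) and the
inverses of the frozen variables. -/
noncomputable def Seed.clusterAlgebra (s : Seed V) : Subring (RatFun V) :=
  Subring.closure
    ({f | ∃ t : Seed V, s.MutEquiv t ∧ ∃ v, f = t.cluster v} ∪
      {f | ∃ v ∈ s.quiver.frozen, f = (s.cluster v)⁻¹})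

/-- The cluster algebra of `s` is acyclic: it has an acyclic seed. -/
def Seed.IsAcyclic (s : Seed V) : Prop :=
  ∃ t : Seed V, s.MutEquiv t ∧ t.quiver.IsAcyclic

/-- Freezing of a seed. -/
def Seed.freeze (s : Seed V) (S : Finset V) : Seed V where
  quiver := s.quiver.freeze S
  cluster := s.cluster

/-- The cluster algebra of `s'` is a cluster localization of that of `s`: `s'` is the freezing of
some seed of the cluster algebra `A` of `s`, and its cluster algebra contains `A`. -/
def Seed.IsClusterLocalization (s s' : Seed V) : Prop :=
  (∃ (t : Seed V) (S : Finset V), s.MutEquiv t ∧ s' = t.freeze S) ∧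
    s.clusterAlgebra ≤ s'.clusterAlgebra

/-- The cluster algebra `A` of `s` is locally acyclic: `Spec A` is covered by finitely many acyclic
cluster charts `Spec A' → Spec A`. -/
def Seed.IsLocallyAcyclic (s : Seed V) : Prop :=
  ∃ C : Set (Seed V), C.Finite ∧ (∀ s' ∈ C, s.IsClusterLocalization s' ∧ s'.IsAcyclic) ∧
    ∀ P : PrimeSpectrum s.clusterAlgebra, ∃ s' ∈ C,
      ∃ h : s.clusterAlgebra ≤ s'.clusterAlgebra,
        P ∈ Set.range (PrimeSpectrum.comap (Subring.inclusion h))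

end

/-- The set `Hom(R, K)` of ring homomorphisms, i.e. the `K`-points of `Spec R`. -/
def Points (R K : Type*) [CommRing R] [CommRing K] : Type _ := R →+* K

/-- The function on `Hom(R, K)` defined by an element of `R`. -/
def Points.eval {R K : Type*} [CommRing R] [CommRing K] (a : R) (p : Points R K) : K :=
  DFunLike.coe (F := R →+* K) p a

/-- The analytic topology on `Hom(R, K)`: the coarsest one for which all evaluations are
continuous (pointwise convergence). -/
instance Points.instTopologicalSpace {R K : Type*} [CommRing R] [CommRing K]
    [TopologicalSpace K] : TopologicalSpace (Points R K) :=
  TopologicalSpace.induced (fun p (a : R) => Points.eval a p) inferInstance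

/-- `Hom(R, 𝕜)` is a `C^r` manifold over `𝕜` of dimension `|ι|`. Its topology is the analytic one,
it is Hausdorff and second countable, and it has a `C^r` atlas for which all elements of `R` are
`C^r` functions whose differentials separate tangent vectors at every point. In other words, for
any generators `g₁, …, g_N` of `R` the embedding `p ↦ (p(g₁), …, p(g_N))` makes `Hom(R, 𝕜)` an
embedded submanifold of `𝕜^N`. -/
def PointsFormManifold (𝕜 : Type*) [RCLike 𝕜] (r : WithTop ℕ∞) (ι : Type*) [Fintype ι]
    (R : Type*) [CommRing R] : Prop :=
  T2Space (Points R 𝕜) ∧ SecondCountableTopology (Points R 𝕜) ∧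
  ∃ _ : ChartedSpace (EuclideanSpace 𝕜 ι) (Points R 𝕜),
    IsManifold 𝓘(𝕜, EuclideanSpace 𝕜 ι) r (Points R 𝕜) ∧
    (∀ a : R, ContMDiff 𝓘(𝕜, EuclideanSpace 𝕜 ι) 𝓘(𝕜, 𝕜) r
      (Points.eval a : Points R 𝕜 → 𝕜)) ∧
    ∀ (p : Points R 𝕜) (v : TangentSpace 𝓘(𝕜, EuclideanSpace 𝕜 ι) p),
      (∀ a : R, mfderiv 𝓘(𝕜, EuclideanSpace 𝕜 ι) 𝓘(𝕜, 𝕜)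
        (Points.eval a : Points R 𝕜 → 𝕜) p v = 0) → v = 0

end ClusterAlg

/-! Fix a point `p` of `Hom(A, k)`. Its kernel comes from an acyclic cluster chart; take an acyclic
seed of that chart and let `S` be the set of vertices whose cluster variables vanish at `p`.
Variables frozen in the chart are invertible there, so `S` consists of mutable vertices. If `i → j`
inside `S`, the exchange relation at `i`, evaluated at `p`, forces an arrow `l → i` with `l ∈ S`; by
acyclicity there are then no arrows inside `S` at all (`Seed.exists_localModel`).

For such a set `S`, the ring `A` is generated, after inverting the nonzero integers and the `x_k`
with `k ∉ S`, by the cluster variables `x_v` and the adjacent variables `x_i'` with `i ∈ S`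
(`leval_mem_of_exchange`). This rests on the Laurent phenomenon in the sharp form that `A` lies in
the upper bound of each seed, which follows from the invariance of upper bounds under mutation
(`Seed.InUpperBound.mutate`). Full rank enters by making the exchange polynomials pairwise coprime.

Near `p`, the points are then the solutions of the `|S|` exchange relations in `n + |S|` unknowns
with `x_k ≠ 0` for `k ∉ S`. Full rank also makes the Jacobian surjective there
(`LocalModel.fderiv_surjective`). That each solution comes from a point is shown analytically
(`LocalModel.exists_point`): solutions with all `x_v ≠ 0` do, by the Laurent phenomenon; they are
dense; and limits of points are points, because the elements of `A` are continuous functions of the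
generators on this locus. The implicit function theorem gives analytic charts of dimension `n` whose
coordinates are linear combinations of elements of `A`. Analytic transition maps and separation of
tangent vectors follow at once. -/

namespace ClusterAlg

/-! ### Coprimality, as regularity of one element modulo another. -/

section RegMod

variable {R : Type*} [CommRing R]

/-- `x` is a nonzerodivisor modulo `y`. -/
def RegMod (x y : R) : Prop := ∀ h, y ∣ x * h → y ∣ h

theorem RegMod.mul_left {x x' y : R} (h : RegMod x y) (h' : RegMod x' y) : RegMod (x * x') y :=
  fun z hz => h' z (h _ (by rwa [← mul_assoc]))

theorem RegMod.one_left (y : R) : RegMod 1 y := fun z hz => by rwa [one_mul] at hz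

theorem RegMod.one_right (x : R) : RegMod x 1 := fun z _ => one_dvd z

theorem RegMod.pow_left {x y : R} (h : RegMod x y) (n : ℕ) : RegMod (x ^ n) y := by
  induction n with
  | zero => simpa using RegMod.one_left y
  | succ n ih => rw [pow_succ]; exact ih.mul_left h

theorem RegMod.mul_right [IsDomain R] {x y y' : R} (h : RegMod x y) (h' : RegMod x y') :
    RegMod x (y * y') := by
  intro z hz
  obtain ⟨w, rfl⟩ := h z ((dvd_mul_right y y').trans hz)
  by_cases hy : y = 0
  · simp [hy]
  · refine mul_dvd_mul_left y (h' w ?_)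
    rw [show x * (y * w) = y * (x * w) by ring] at hz
    exact (mul_dvd_mul_iff_left hy).1 hz

theorem RegMod.pow_right [IsDomain R] {x y : R} (h : RegMod x y) (n : ℕ) : RegMod x (y ^ n) := by
  induction n with
  | zero => simpa using RegMod.one_right x
  | succ n ih => rw [pow_succ]; exact ih.mul_right h

theorem RegMod.of_isUnit {x : R} (hx : IsUnit x) (y : R) : RegMod x y := fun z hz => by
  obtain ⟨u, rfl⟩ := hx
  exact (Units.dvd_mul_left).1 hz

theorem RegMod.unit_mul_right {x y u : R} (hu : IsUnit u) (h : RegMod x y) : RegMod x (u * y) := by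
  obtain ⟨u, rfl⟩ := hu
  intro z hz
  rw [Units.mul_left_dvd] at hz ⊢
  exact h z hz

/-- Being a nonzerodivisor modulo `y` only depends on the class modulo `y`. -/
theorem RegMod.add_mul {x y : R} (h : RegMod x y) (r : R) : RegMod (x + y * r) y := fun z hz => by
  refine h z ?_
  have : x * z = (x + y * r) * z - y * (r * z) := by ring
  rw [this]
  exact dvd_sub hz (dvd_mul_right _ _)

theorem RegMod.mul_dvd {x y z : R} (h : RegMod x y) (hx : x ∣ z) (hy : y ∣ z) : x * y ∣ z := by
  obtain ⟨w, rfl⟩ := hx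
  exact mul_dvd_mul_left x (h w hy)

theorem RegMod.prod_left {ι : Type*} (s : Finset ι) {f : ι → R} {y : R}
    (h : ∀ i ∈ s, RegMod (f i) y) : RegMod (∏ i ∈ s, f i) y :=
  Finset.prod_induction f (fun x => RegMod x y) (fun _ _ => RegMod.mul_left)
    (RegMod.one_left y) h

theorem prod_dvd_of_regMod {ι : Type*} (s : Finset ι) {f : ι → R} {z : R}
    (h : ∀ i ∈ s, ∀ j ∈ s, i ≠ j → RegMod (f i) (f j)) (hz : ∀ i ∈ s, f i ∣ z) :
    ∏ i ∈ s, f i ∣ z := by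
  classical
  induction s using Finset.induction_on with
  | empty => simp
  | insert a s ha ih =>
    rw [Finset.prod_insert ha, mul_comm]
    refine RegMod.mul_dvd (RegMod.prod_left s fun i hi => ?_) (ih ?_ ?_) (hz a (by simp))
    · exact h i (by simp [hi]) a (by simp) (fun e => ha (e ▸ hi))
    · exact fun i hi j hj => h i (by simp [hi]) j (by simp [hj])
    · exact fun i hi => hz i (by simp [hi])

/-- In a `ℤ`-graded ring, a homogeneous unit of nonzero degree plus an element of degree zero is a
nonzerodivisor modulo any element of degree zero. -/
theorem regMod_add_of_graded {σ : Type*} [SetLike σ R] [AddSubgroupClass σ R] (𝒜 : ℤ → σ)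
    [GradedRing 𝒜] {P m c : R} {e : ℤ} (he : e ≠ 0) (hP : P ∈ 𝒜 0) (hm : m ∈ 𝒜 e)
    (hu : IsUnit m) (hc : c ∈ 𝒜 0) : RegMod (m + c) P := by
  classical
  rintro h ⟨g, hg⟩
  -- In degree `e + n` the equation `(m + c) * h = P * g` reads `m h_n + c h_{e+n} = P g_{e+n}`, and
  -- `m` is a unit.
  have step : ∀ n : ℤ, P ∣ (DirectSum.decompose 𝒜 h (e + n) : R) →
      P ∣ (DirectSum.decompose 𝒜 h n : R) := by
    intro n hn
    have h1 := congrArg (fun x => (DirectSum.decompose 𝒜 x (e + n) : R)) hg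
    simp only [add_mul, DirectSum.decompose_add, DirectSum.add_apply, AddMemClass.coe_add] at h1
    rw [DirectSum.coe_decompose_mul_add_of_left_mem 𝒜 hm,
      DirectSum.coe_decompose_mul_of_left_mem_zero 𝒜 hc,
      DirectSum.coe_decompose_mul_of_left_mem_zero 𝒜 hP] at h1
    refine RegMod.of_isUnit hu P _ ?_
    rw [eq_sub_of_add_eq h1]
    exact dvd_sub (dvd_mul_right _ _) (hn.mul_left c)
  have all : ∀ n : ℤ, P ∣ (DirectSum.decompose 𝒜 h n : R) := by
    intro n
    have cast : ∀ i j : ℤ, i = j → P ∣ (DirectSum.decompose 𝒜 h i : R) →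
        P ∣ (DirectSum.decompose 𝒜 h j : R) := by rintro i _ rfl; exact id
    have down : ∀ (k : ℕ) (n : ℤ), P ∣ (DirectSum.decompose 𝒜 h (k * e + n) : R) →
        P ∣ (DirectSum.decompose 𝒜 h n : R) := by
      intro k
      induction k with
      | zero => exact fun n hn => cast _ _ (by simp) hn
      | succ k ih =>
        intro n hn
        exact step n (ih (e + n) (cast _ _ (by push_cast; ring) hn))
    -- The degrees `k * e + n` are infinitely many, so one of them lies outside the support of `h`;
    -- divisibility descends from there.
    have hinj : Function.Injective fun k : ℕ => (k : ℤ) * e + n := fun a b hab => by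
      simpa [he] using hab
    obtain ⟨_, ⟨k, rfl⟩, hk⟩ := (Set.infinite_range_of_injective hinj).exists_notMem_finset
      ((DirectSum.decompose 𝒜 h).support)
    refine down k n ?_
    rw [DFinsupp.notMem_support_iff.1 hk]
    simp
  rw [← DirectSum.sum_support_decompose 𝒜 h]
  exact Finset.dvd_sum fun i _ => all i

end RegMod

/-! ### Laurent polynomials, their gradings, and exchange polynomials. -/

section LaurentRing

variable (V : Type*)

/-- Laurent polynomials with rational coefficients in variables indexed by `V`. -/
abbrev LaurentRing : Type _ := AddMonoidAlgebra ℚ (V → ℤ)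

variable {V}

/-- The Laurent monomial with exponent vector `α`. -/
noncomputable def mon (α : V → ℤ) : LaurentRing V := AddMonoidAlgebra.single α 1

theorem mon_add (α β : V → ℤ) : mon (α + β) = mon α * mon β := by
  simp [mon, AddMonoidAlgebra.single_mul_single]

theorem mon_zero : mon (0 : V → ℤ) = 1 := rfl

theorem isUnit_mon (α : V → ℤ) : IsUnit (mon α) :=
  IsUnit.of_mul_eq_one (mon (-α)) (by rw [← mon_add, add_neg_cancel, mon_zero])

theorem single_eq_smul_mon (α : V → ℤ) (r : ℚ) :
    (AddMonoidAlgebra.single α r : LaurentRing V) = r • mon α := by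
  simp [mon, AddMonoidAlgebra.smul_single]

/-- The exchange polynomial attached to a row of an exchange matrix. -/
noncomputable def exch (q : V → ℤ) : LaurentRing V := mon q⁺ + mon q⁻

theorem exch_neg (q : V → ℤ) : exch (-q) = exch q := by
  rw [exch, exch, posPart_neg, negPart_neg, add_comm]

theorem exch_eq (q : V → ℤ) : exch q = mon q⁻ * (mon q + 1) := by
  rw [mul_add, ← mon_add, mul_one, exch]
  congr 2
  rw [eq_comm, add_comm, ← sub_eq_iff_eq_add.1 (posPart_sub_negPart q)]

section Grading

variable {ι : Type*} [DecidableEq ι] [AddMonoid ι]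

omit [DecidableEq ι] in
theorem mon_mem_gradeBy (d : (V → ℤ) →+ ι) (α : V → ℤ) :
    mon α ∈ AddMonoidAlgebra.gradeBy ℚ d (d α) :=
  AddMonoidAlgebra.single_mem_gradeBy d α 1

omit [DecidableEq ι] in
theorem mon_mem_gradeBy_of_eq (d : (V → ℤ) →+ ι) {α : V → ℤ} {n : ι} (h : d α = n) :
    mon α ∈ AddMonoidAlgebra.gradeBy ℚ d n := h ▸ mon_mem_gradeBy d α

theorem coeff_decompose_gradeBy (d : (V → ℤ) →+ ι) (f : LaurentRing V) (n : ι) (α : V → ℤ) :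
    (DirectSum.decompose (AddMonoidAlgebra.gradeBy ℚ d) f n : LaurentRing V).coeff α =
      if d α = n then f.coeff α else 0 := by
  induction f using AddMonoidAlgebra.induction_linear with
  | zero => simp
  | add f g hf hg =>
    rw [DirectSum.decompose_add, DirectSum.add_apply, Submodule.coe_add,
      AddMonoidAlgebra.coeff_add, Finsupp.add_apply, hf, hg]
    split_ifs <;> simp
  | single β r =>
    rw [AddMonoidAlgebra.GradesBy.decompose_single]
    by_cases h : d β = n
    · subst h
      rw [DirectSum.of_eq_same]
      by_cases h2 : β = α
      · subst h2; simp
      · simp [AddMonoidAlgebra.coeff_single, h2]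
    · rw [DirectSum.of_eq_of_ne _ _ _ (Ne.symm h)]
      by_cases h2 : β = α
      · subst h2; simp [h]
      · simp [AddMonoidAlgebra.coeff_single, h2]

end Grading

/-- The degree in the variable with index `k`. -/
def coordDeg (k : V) : (V → ℤ) →+ ℤ := Pi.evalAddMonoidHom _ k

@[simp] theorem coordDeg_apply (k : V) (α : V → ℤ) : coordDeg k α = α k := rfl

/-- The exponents of the variables indexed by `S`. -/
def restrictDeg (S : Finset V) : (V → ℤ) →+ (S → ℤ) where
  toFun α i := α i
  map_zero' := rfl
  map_add' _ _ := rfl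

@[simp] theorem restrictDeg_apply (S : Finset V) (α : V → ℤ) (i : S) :
    restrictDeg S α i = α i := rfl

theorem posPart_apply_eq_zero {q : V → ℤ} {k : V} (h : q k = 0) : q⁺ k = 0 := by
  simp [Pi.posPart_apply, h]

theorem negPart_apply_eq_zero {q : V → ℤ} {k : V} (h : q k = 0) : q⁻ k = 0 := by
  simp [Pi.negPart_apply, h]

theorem exch_mem_coordDeg {q : V → ℤ} {k : V} (h : q k = 0) :
    exch q ∈ AddMonoidAlgebra.gradeBy ℚ (coordDeg k) 0 :=
  add_mem (mon_mem_gradeBy_of_eq _ (by simp [posPart_apply_eq_zero h]))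
    (mon_mem_gradeBy_of_eq _ (by simp [negPart_apply_eq_zero h]))

theorem exch_mem_restrictDeg [DecidableEq V] {q : V → ℤ} {S : Finset V} (h : ∀ k ∈ S, q k = 0) :
    exch q ∈ AddMonoidAlgebra.gradeBy ℚ (restrictDeg S) 0 :=
  add_mem (mon_mem_gradeBy_of_eq _ (by ext i; simp [posPart_apply_eq_zero (h i i.2)]))
    (mon_mem_gradeBy_of_eq _ (by ext i; simp [negPart_apply_eq_zero (h i i.2)]))

/-- The degree for which the variable with index `v` has weight `x v`. -/
def weightDeg [Fintype V] (x : V → ℤ) : (V → ℤ) →+ ℤ where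
  toFun α := α ⬝ᵥ x
  map_zero' := by simp
  map_add' _ _ := by simp [add_dotProduct]

/-- The weight `x` makes `exch q` a unit times an element of degree zero, while `mon q'` is a unit
of nonzero degree. Full rank provides such weights for any two mutable rows. -/
theorem regMod_mon_add_one_exch [Fintype V] {q q' x : V → ℤ} (hq : q ⬝ᵥ x = 0)
    (hq' : q' ⬝ᵥ x ≠ 0) : RegMod (mon q' + 1) (exch q) := by
  rw [exch_eq]
  refine RegMod.unit_mul_right (isUnit_mon _) ?_
  refine regMod_add_of_graded (AddMonoidAlgebra.gradeBy ℚ (weightDeg x)) hq'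
    (add_mem (mon_mem_gradeBy_of_eq _ hq) ?_) (mon_mem_gradeBy (weightDeg x) q') (isUnit_mon _) ?_
  all_goals rw [← mon_zero]; exact mon_mem_gradeBy_of_eq _ (map_zero _)

theorem regMod_exch [Fintype V] {q q' x : V → ℤ} (hq : q ⬝ᵥ x = 0)
    (hq' : q' ⬝ᵥ x ≠ 0) : RegMod (exch q') (exch q) := by
  rw [exch_eq q']
  exact (RegMod.of_isUnit (isUnit_mon _) _).mul_left (regMod_mon_add_one_exch hq hq')

end LaurentRing

/-! ### Laurent rings of a family of units in a field. -/

section Laurent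

variable {V : Type*} [Fintype V] {F : Type*} [Field F]

/-- The value of a Laurent monomial at a family of units. -/
def lmono (a : V → Fˣ) (α : V → ℤ) : Fˣ := ∏ v, a v ^ α v

theorem lmono_zero (a : V → Fˣ) : lmono a 0 = 1 := by simp [lmono]

theorem lmono_add (a : V → Fˣ) (α β : V → ℤ) : lmono a (α + β) = lmono a α * lmono a β := by
  simp [lmono, zpow_add, Finset.prod_mul_distrib]

theorem lmono_neg (a : V → Fˣ) (α : V → ℤ) : lmono a (-α) = (lmono a α)⁻¹ := by
  simp [lmono]

theorem lmono_sub (a : V → Fˣ) (α β : V → ℤ) : lmono a (α - β) = lmono a α / lmono a β := by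
  rw [sub_eq_add_neg, lmono_add, lmono_neg, div_eq_mul_inv]

theorem lmono_zsmul (a : V → Fˣ) (n : ℤ) (α : V → ℤ) : lmono a (n • α) = lmono a α ^ n := by
  simp only [lmono, ← Finset.prod_zpow, Pi.smul_apply, smul_eq_mul]
  exact Finset.prod_congr rfl fun v _ => by rw [mul_comm, zpow_mul]

variable [DecidableEq V]

theorem lmono_single (a : V → Fˣ) (k : V) (n : ℤ) : lmono a (Pi.single k n) = a k ^ n := by
  rw [lmono, Finset.prod_eq_single k]
  · simp
  · intro v _ hv; simp [hv]
  · simp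

theorem lmono_update (a : V → Fˣ) (k : V) (c : Fˣ) (α : V → ℤ) :
    lmono (Function.update a k c) α = lmono a α * (c / a k) ^ α k := by
  rw [lmono, lmono, ← Finset.mul_prod_erase _ _ (Finset.mem_univ k),
    ← Finset.mul_prod_erase _ _ (Finset.mem_univ k), Function.update_self, div_zpow]
  rw [Finset.prod_congr rfl (g := fun v => a v ^ α v)
    fun v hv => by rw [Function.update_of_ne (Finset.ne_of_mem_erase hv)]]
  rw [mul_right_comm, mul_div_cancel]

theorem lmono_update_of_eq_zero (a : V → Fˣ) (k : V) (c : Fˣ) {α : V → ℤ} (h : α k = 0) :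
    lmono (Function.update a k c) α = lmono a α := by
  rw [lmono_update, h, zpow_zero, mul_one]

variable [Algebra ℚ F]

omit [DecidableEq V] in
/-- Evaluation of Laurent polynomials at a family of units. -/
noncomputable def leval (a : V → Fˣ) : LaurentRing V →ₐ[ℚ] F :=
  AddMonoidAlgebra.lift ℚ F (V → ℤ)
    { toFun := fun α => (lmono a α.toAdd : F)
      map_one' := by simp [lmono_zero]
      map_mul' := fun α β => by simp [lmono_add] }

omit [DecidableEq V] in
theorem leval_mon (a : V → Fˣ) (α : V → ℤ) : leval a (mon α) = lmono a α := by
  simp [leval, mon]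

omit [DecidableEq V] in
theorem leval_eq_sum (a : V → Fˣ) (f : LaurentRing V) :
    leval a f = ∑ α ∈ f.coeff.support, f.coeff α • (lmono a α : F) := by
  simp [leval, AddMonoidAlgebra.lift_apply, Finsupp.sum]

omit [DecidableEq V] in
/-- The ring of Laurent polynomials in a family of units. -/
noncomputable def laur (a : V → Fˣ) : Subalgebra ℚ F := (leval a).range

omit [DecidableEq V] in
theorem leval_mem_laur (a : V → Fˣ) (f : LaurentRing V) : leval a f ∈ laur a := ⟨f, rfl⟩

omit [DecidableEq V] in
theorem lmono_mem_laur (a : V → Fˣ) (α : V → ℤ) : (lmono a α : F) ∈ laur a :=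
  ⟨mon α, leval_mon a α⟩

theorem apply_mem_laur (a : V → Fˣ) (v : V) : (a v : F) ∈ laur a := by
  have := lmono_mem_laur a (Pi.single v 1)
  rwa [lmono_single, zpow_one] at this

theorem inv_apply_mem_laur (a : V → Fˣ) (v : V) : ((a v)⁻¹ : F) ∈ laur a := by
  have := lmono_mem_laur a (Pi.single v (-1))
  rwa [lmono_single, zpow_neg_one, Units.val_inv_eq_inv_val] at this

theorem leval_update_of_mem_zero (a : V → Fˣ) (k : V) (c : Fˣ) {p : LaurentRing V}
    (hp : p ∈ AddMonoidAlgebra.gradeBy ℚ (coordDeg k) 0) :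
    leval (Function.update a k c) p = leval a p := by
  rw [leval_eq_sum, leval_eq_sum]
  refine Finset.sum_congr rfl fun α hα => ?_
  rw [lmono_update_of_eq_zero]
  exact (AddMonoidAlgebra.mem_gradeBy_iff ℚ _ _ _).1 hp hα

omit [DecidableEq V] in
/-- If `D` is a common denominator of the inverses of the units `c v`, then every Laurent polynomial
in the `c v` becomes an element of `B` after multiplication by a power of `D`. -/
theorem exists_pow_mul_mem_of_mem_laur {B : Subalgebra ℚ F} {D : F} (hD : D ∈ B) {c : V → Fˣ}
    (hc : ∀ v, (c v : F) ∈ B) (hc' : ∀ v, D * (c v : F)⁻¹ ∈ B) {f : F} (hf : f ∈ laur c) :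
    ∃ N : ℕ, D ^ N * f ∈ B := by
  -- Elements carried into `B` by a power of `D` form a subalgebra, so only the units and their
  -- inverses have to be treated.
  let T : Subalgebra ℚ F :=
    { carrier := {f | ∃ N : ℕ, D ^ N * f ∈ B}
      mul_mem' := by
        rintro f g ⟨N, hN⟩ ⟨M, hM⟩
        refine ⟨N + M, ?_⟩
        have := B.mul_mem hN hM
        rwa [mul_mul_mul_comm, ← pow_add] at this
      add_mem' := by
        rintro f g ⟨N, hN⟩ ⟨M, hM⟩
        refine ⟨N + M, ?_⟩
        have : D ^ (N + M) * (f + g) = D ^ M * (D ^ N * f) + D ^ N * (D ^ M * g) := by ring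
        rw [this]
        exact B.add_mem (B.mul_mem (B.pow_mem hD _) hN) (B.mul_mem (B.pow_mem hD _) hM)
      algebraMap_mem' := fun r => ⟨0, by simpa using B.algebraMap_mem r⟩ }
  obtain ⟨f, rfl⟩ := hf
  change leval c f ∈ T
  rw [leval_eq_sum]
  refine T.sum_mem fun α _ => T.smul_mem ?_ _
  rw [lmono, Units.coe_prod]
  refine T.prod_mem fun v _ => ?_
  rw [Units.val_zpow_eq_zpow_val]
  rcases Int.eq_nat_or_neg (α v) with ⟨n, hn | hn⟩
  · rw [hn, zpow_natCast]
    exact T.pow_mem ⟨0, by simpa using hc v⟩ n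
  · rw [hn, zpow_neg, zpow_natCast, ← inv_pow]
    exact T.pow_mem ⟨1, by simpa using hc' v⟩ n

omit [DecidableEq V] in
-- Two coprime denominators: `f = f1 / P^N` and `D^M f` is Laurent, so `P^N` divides `D^M f1` and
-- hence `f1`.
theorem mem_laur_of_regMod {w : V → Fˣ} (hw : Function.Injective (leval w)) {P D : LaurentRing V}
    (hP : P ≠ 0) (h : RegMod D P) {f : F} {N M : ℕ} (h1 : leval w P ^ N * f ∈ laur w)
    (h2 : leval w D ^ M * f ∈ laur w) : f ∈ laur w := by
  obtain ⟨f1, h1 : leval w f1 = _⟩ := h1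
  obtain ⟨f2, h2 : leval w f2 = _⟩ := h2
  have h3 : D ^ M * f1 = P ^ N * f2 := hw (by simp only [map_mul, map_pow, h1, h2]; ring)
  obtain ⟨g, rfl⟩ := (h.pow_left M).pow_right N f1 ⟨f2, h3⟩
  have hP' : leval w P ^ N ≠ 0 := pow_ne_zero _ (by simpa using hw.ne hP)
  rw [map_mul, map_pow, mul_right_inj' hP'] at h1
  exact ⟨g, h1⟩

end Laurent

/-! ### Laurent polynomials under a single exchange; lower bounds. -/

section Flip

variable {V : Type*} [DecidableEq V]

/-- Change the sign of the coordinate with index `k`. -/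
def flipCoord (k : V) : (V → ℤ) →+ (V → ℤ) where
  toFun α := Function.update α k (-α k)
  map_zero' := by simp
  map_add' α β := by
    ext v
    by_cases h : v = k
    · subst h; simp [add_comm]
    · simp [h]

theorem flipCoord_apply (k : V) (α : V → ℤ) : flipCoord k α = Function.update α k (-α k) := rfl

theorem flipCoord_flipCoord (k : V) (α : V → ℤ) : flipCoord k (flipCoord k α) = α := by
  simp [flipCoord_apply]

theorem flipCoord_injective (k : V) : Function.Injective (flipCoord k) :=
  Function.LeftInverse.injective (flipCoord_flipCoord k)

/-- Invert the variable with index `k`. -/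
noncomputable def flipVar (k : V) : LaurentRing V →ₐ[ℚ] LaurentRing V :=
  AddMonoidAlgebra.mapDomainAlgHom ℚ ℚ (flipCoord k)

theorem coeff_flipVar (k : V) (f : LaurentRing V) :
    (flipVar k f).coeff = f.coeff.mapDomain (flipCoord k) := by
  simp [flipVar, AddMonoidAlgebra.mapDomain]

theorem flipVar_injective (k : V) : Function.Injective (flipVar k) := fun f g h =>
  AddMonoidAlgebra.coeff_injective (Finsupp.mapDomain_injective (flipCoord_injective k)
    (by rw [← coeff_flipVar, ← coeff_flipVar, h]))

theorem flipVar_mem {k : V} {n : ℤ} {f : LaurentRing V}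
    (hf : f ∈ AddMonoidAlgebra.gradeBy ℚ (coordDeg k) n) :
    flipVar k f ∈ AddMonoidAlgebra.gradeBy ℚ (coordDeg k) (-n) := by
  rw [AddMonoidAlgebra.mem_gradeBy_iff] at hf ⊢
  intro α hα
  classical
  rw [coeff_flipVar] at hα
  obtain ⟨β, hβ, rfl⟩ := Finset.mem_image.1 (Finsupp.mapDomain_support hα)
  have := hf hβ
  simp_all [flipCoord_apply]

variable [Fintype V] {F : Type*} [Field F] [Algebra ℚ F]

/-- The new variable is `p / a k`, so its `n`-th power contributes `p ^ n` and inverts the old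
variable. -/
theorem leval_update_of_mem {a : V → Fˣ} {k : V} {c : Fˣ} {p g : LaurentRing V} {n : ℤ}
    (hc : (c : F) * a k = leval a p) (hg : g ∈ AddMonoidAlgebra.gradeBy ℚ (coordDeg k) n) :
    leval (Function.update a k c) g = leval a p ^ n * leval a (flipVar k g) := by
  classical
  rw [leval_eq_sum, leval_eq_sum a (flipVar k g), coeff_flipVar,
    Finsupp.mapDomain_support_of_injective (flipCoord_injective k), Finset.sum_image
      (flipCoord_injective k).injOn, Finset.mul_sum]
  refine Finset.sum_congr rfl fun α hα => ?_
  have hn : α k = n := (AddMonoidAlgebra.mem_gradeBy_iff ℚ _ _ _).1 hg hα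
  rw [Finsupp.mapDomain_apply (flipCoord_injective k), mul_smul_comm]
  congr 1
  have h1 : flipCoord k α = α + Pi.single k (-2 * n) := by
    ext v
    by_cases h : v = k
    · subst h; simp [flipCoord_apply, hn]; ring
    · simp [flipCoord_apply, h]
  have h2 : (leval a p) = ((c * a k : Fˣ) : F) := by rw [← hc, Units.val_mul]
  rw [lmono_update, h1, lmono_add, lmono_single, h2, ← Units.val_zpow_eq_zpow_val,
    ← Units.val_mul, hn]
  congr 1
  have h3 : a k ^ (-2 * n) = (a k ^ n)⁻¹ * (a k ^ n)⁻¹ := by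
    rw [← zpow_neg, ← zpow_add]; ring_nf
  rw [div_zpow, mul_zpow, h3, show c ^ n * a k ^ n * (lmono a α * ((a k ^ n)⁻¹ * (a k ^ n)⁻¹)) =
    lmono a α * (c ^ n * (a k ^ n)⁻¹) * (a k ^ n * (a k ^ n)⁻¹) by ac_rfl, mul_inv_cancel, mul_one,
    div_eq_mul_inv]

/-- Clearing the denominators of a Laurent polynomial in a mutated cluster. -/
theorem exists_clear_update {a : V → Fˣ} {k : V} {c : Fˣ} {p : LaurentRing V}
    (hc : (c : F) * a k = leval a p) (hp : p ∈ AddMonoidAlgebra.gradeBy ℚ (coordDeg k) 0)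
    (g : LaurentRing V) :
    ∃ (N : ℕ) (G : LaurentRing V),
      leval a p ^ N * leval (Function.update a k c) g = leval a G ∧
      ∀ n : ℤ, ∃ M : ℕ, (M : ℤ) = max (N + n) 0 ∧
        (DirectSum.decompose (AddMonoidAlgebra.gradeBy ℚ (coordDeg k)) G (-n) : LaurentRing V) =
          p ^ M * flipVar k (DirectSum.decompose (AddMonoidAlgebra.gradeBy ℚ (coordDeg k)) g n) := by
  classical
  set 𝒜 := AddMonoidAlgebra.gradeBy ℚ (coordDeg k) with h𝒜
  set s := (DirectSum.decompose 𝒜 g).support with hs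
  have hp0 : leval a p ≠ 0 := by rw [← hc]; simp
  obtain ⟨N, hN⟩ : ∃ N : ℕ, ∀ n ∈ s, 0 ≤ (N : ℤ) + n := by
    refine ⟨∑ n ∈ s, n.natAbs, fun n hn => ?_⟩
    have := Finset.single_le_sum (f := fun n : ℤ => n.natAbs) (fun _ _ => Nat.zero_le _) hn
    omega
  -- On the support `N + n` is nonnegative; elsewhere the truncation by `toNat` is harmless because
  -- the component of `g` is zero.
  refine ⟨N, ∑ n ∈ s, p ^ (N + n).toNat * flipVar k (DirectSum.decompose 𝒜 g n : LaurentRing V),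
    ?_, fun n => ⟨(N + n).toNat, by simp, ?_⟩⟩
  · conv_lhs => rw [← DirectSum.sum_support_decompose 𝒜 g]
    rw [map_sum, map_sum, Finset.mul_sum]
    refine Finset.sum_congr rfl fun n hn => ?_
    rw [leval_update_of_mem hc (DirectSum.decompose 𝒜 g n).2, map_mul, map_pow, ← mul_assoc,
      ← zpow_natCast, ← zpow_natCast, ← zpow_add₀ hp0, Int.toNat_of_nonneg (hN n hn)]
  · have hmem : ∀ m : ℤ, p ^ (N + m).toNat * flipVar k (DirectSum.decompose 𝒜 g m : LaurentRing V)
        ∈ 𝒜 (-m) := fun m => by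
      have h0 : p ^ (N + m).toNat ∈ 𝒜 0 := by
        simpa using SetLike.pow_mem_graded (A := 𝒜) (N + m).toNat hp
      simpa using SetLike.mul_mem_graded (A := 𝒜) h0 (flipVar_mem (DirectSum.decompose 𝒜 g m).2)
    rw [DirectSum.decompose_sum, DFinsupp.finsetSum_apply, AddSubmonoidClass.coe_finsetSum]
    rw [Finset.sum_eq_single n]
    · exact DirectSum.decompose_of_mem_same 𝒜 (hmem n)
    · intro m _ hmn
      exact DirectSum.decompose_of_mem_ne 𝒜 (hmem m) (by simpa using hmn)
    · intro hn
      rw [DFinsupp.notMem_support_iff.1 hn]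
      simp

/-- If `g` evaluates to zero, the polynomial `G` obtained by clearing denominators is zero, and its
components are those of `g`, flipped and multiplied by powers of `p ≠ 0`. -/
theorem leval_update_injective {a : V → Fˣ} (ha : Function.Injective (leval a)) {k : V} {c : Fˣ}
    {p : LaurentRing V} (hc : (c : F) * a k = leval a p)
    (hp : p ∈ AddMonoidAlgebra.gradeBy ℚ (coordDeg k) 0) :
    Function.Injective (leval (Function.update a k c)) := by
  classical
  rw [injective_iff_map_eq_zero] at ha ⊢
  intro g hg
  obtain ⟨N, G, h1, h2⟩ := exists_clear_update hc hp g
  rw [hg, mul_zero] at h1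
  have hG : G = 0 := ha G h1.symm
  have hp0 : p ≠ 0 := fun h => by simp [h] at hc
  rw [← DirectSum.sum_support_decompose (AddMonoidAlgebra.gradeBy ℚ (coordDeg k)) g]
  refine Finset.sum_eq_zero fun n _ => ?_
  obtain ⟨M, -, h3⟩ := h2 n
  rw [hG, DirectSum.decompose_zero] at h3
  have h4 := (mul_eq_zero.1 h3.symm).resolve_left (pow_ne_zero _ hp0)
  exact flipVar_injective k (by rw [h4, map_zero])

/-- A Laurent polynomial that remains one after an exchange is divisible, in negative degrees, by
powers of the exchange polynomial. -/
theorem pow_dvd_decompose {a : V → Fˣ} (ha : Function.Injective (leval a)) {k : V} {c : Fˣ}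
    {p : LaurentRing V} (hc : (c : F) * a k = leval a p)
    (hp : p ∈ AddMonoidAlgebra.gradeBy ℚ (coordDeg k) 0) {f : LaurentRing V}
    (hf : leval a f ∈ laur (Function.update a k c)) (n : ℕ) :
    p ^ n ∣ (DirectSum.decompose (AddMonoidAlgebra.gradeBy ℚ (coordDeg k)) f (-n : ℤ) :
      LaurentRing V) := by
  obtain ⟨g, hg : leval _ g = _⟩ := hf
  obtain ⟨N, G, h1, h2⟩ := exists_clear_update hc hp g
  have hp0 : p ≠ 0 := fun h => by simp [h] at hc
  have hG : p ^ N * f = G := ha (by rw [← h1, map_mul, map_pow, hg])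
  obtain ⟨M, hM, h3⟩ := h2 n
  have h0 : p ^ N ∈ AddMonoidAlgebra.gradeBy ℚ (coordDeg k) 0 := by
    simpa using SetLike.pow_mem_graded (A := AddMonoidAlgebra.gradeBy ℚ (coordDeg k)) N hp
  -- In degree `-n` the equality is `p^N f_{-n} = p^{N+n} flip(g_n)`, from which `p^N` cancels.
  rw [← hG, DirectSum.coe_decompose_mul_of_left_mem_zero _ h0, show M = N + n by omega, pow_add,
    mul_assoc] at h3
  exact ⟨_, mul_left_cancel₀ (pow_ne_zero _ hp0) h3⟩

omit [DecidableEq V] [Fintype V] in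
-- The component of multidegree `m` is a part of the component of degree `m k` in the variable `k`,
-- and multiplication by `p` preserves multidegrees.
theorem dvd_decompose_restrictDeg {p f : LaurentRing V} {k : V} {S : Finset V} (hk : k ∈ S)
    (hp : p ∈ AddMonoidAlgebra.gradeBy ℚ (restrictDeg S) 0) (m : S → ℤ)
    (h : p ∣ (DirectSum.decompose (AddMonoidAlgebra.gradeBy ℚ (coordDeg k)) f (m ⟨k, hk⟩) :
      LaurentRing V)) :
    p ∣ (DirectSum.decompose (AddMonoidAlgebra.gradeBy ℚ (restrictDeg S)) f m :
      LaurentRing V) := by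
  obtain ⟨g, hg⟩ := h
  refine ⟨DirectSum.decompose (AddMonoidAlgebra.gradeBy ℚ (restrictDeg S)) g m, ?_⟩
  rw [← DirectSum.coe_decompose_mul_of_left_mem_zero _ hp, ← hg]
  refine AddMonoidAlgebra.coeff_injective (Finsupp.ext fun α => ?_)
  simp only [coeff_decompose_gradeBy]
  split_ifs with h1 h2
  · rfl
  · exact absurd (congrFun h1 ⟨k, hk⟩) h2
  · rfl

/-- The ring generated by the exchange pairs of pairwise non-adjacent vertices and by Laurent
monomials in the other variables contains all elements that are Laurent polynomials in the given
cluster and in its mutations. -/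
theorem leval_mem_of_exchange {a : V → Fˣ} (ha : Function.Injective (leval a)) {S : Finset V}
    {c : V → Fˣ} {p : V → LaurentRing V} (hc : ∀ k ∈ S, (c k : F) * a k = leval a (p k))
    (hp : ∀ k ∈ S, p k ∈ AddMonoidAlgebra.gradeBy ℚ (restrictDeg S) 0)
    (hp' : ∀ k ∈ S, p k ∈ AddMonoidAlgebra.gradeBy ℚ (coordDeg k) 0)
    (hreg : ∀ k ∈ S, ∀ l ∈ S, k ≠ l → RegMod (p k) (p l)) {f : F} (hf : f ∈ laur a)
    (hf' : ∀ k ∈ S, f ∈ laur (Function.update a k (c k))) {B : Subalgebra ℚ F}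
    (hB : ∀ v, (a v : F) ∈ B) (hB' : ∀ v ∉ S, ((a v)⁻¹ : F) ∈ B) (hB'' : ∀ k ∈ S, (c k : F) ∈ B) :
    f ∈ B := by
  classical
  obtain ⟨f, rfl : leval a f = _⟩ := hf
  set 𝒜 := AddMonoidAlgebra.gradeBy ℚ (restrictDeg S) with h𝒜
  change leval a f ∈ B
  rw [← DirectSum.sum_support_decompose 𝒜 f, map_sum]
  refine B.sum_mem fun m _ => ?_
  have h0 : ∏ k : S, p k ^ (-m k).toNat ∈ 𝒜 0 := by
    have := SetLike.prod_mem_graded (A := 𝒜) (fun _ : S => 0) (fun k : S => p k ^ (-m k).toNat)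
      (F := Finset.univ) fun k _ => by
        simpa using SetLike.pow_mem_graded (A := 𝒜) (-m k).toNat (hp k k.2)
    simpa using this
  -- The factors are pairwise coprime, so each may be treated alone; for `m k < 0` its divisibility
  -- expresses that `f` stays Laurent after the exchange at `k`.
  have hdvd : ∏ k : S, p k ^ (-m k).toNat ∣ (DirectSum.decompose 𝒜 f m : LaurentRing V) := by
    refine prod_dvd_of_regMod _ (fun k _ l _ hkl => ?_) fun k _ => ?_
    · exact ((hreg k k.2 l l.2 (fun h => hkl (Subtype.ext h))).pow_left _).pow_right _
    · rcases le_or_gt 0 (m k) with hm | hm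
      · rw [Int.toNat_of_nonpos (by omega), pow_zero]
        exact one_dvd _
      · refine dvd_decompose_restrictDeg k.2 ?_ m ?_
        · simpa using SetLike.pow_mem_graded (A := 𝒜) (-m k).toNat (hp k k.2)
        · have := pow_dvd_decompose ha (hc k k.2) (hp' k k.2) (hf' k k.2) (-m k).toNat
          rwa [Int.toNat_of_nonneg (by omega), neg_neg] at this
  obtain ⟨g, hg⟩ := hdvd
  have hg' : (DirectSum.decompose 𝒜 f m : LaurentRing V) =
      (∏ k : S, p k ^ (-m k).toNat) * (DirectSum.decompose 𝒜 g m : LaurentRing V) := by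
    rw [← DirectSum.coe_decompose_mul_of_left_mem_zero _ h0, ← hg]
    exact (DirectSum.decompose_of_mem_same 𝒜 (DirectSum.decompose 𝒜 f m).2).symm
  rw [hg', map_mul, leval_eq_sum a (DirectSum.decompose 𝒜 g m : LaurentRing V), Finset.mul_sum]
  refine B.sum_mem fun α hα => ?_
  have hα' : restrictDeg S α = m :=
    (AddMonoidAlgebra.mem_gradeBy_iff ℚ _ _ _).1 (DirectSum.decompose 𝒜 g m).2 hα
  rw [mul_smul_comm]
  refine B.smul_mem ?_ _
  -- Each `p k` evaluates to `c k * a k`, whose powers absorb the negative powers of `a k`.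
  have hpw : leval a (∏ k : S, p k ^ (-m k).toNat) =
      ∏ k ∈ S, ((c k : F) * a k) ^ (-α k).toNat := by
    rw [map_prod, ← Finset.prod_coe_sort S]
    refine Finset.prod_congr rfl fun k _ => ?_
    rw [map_pow, hc k k.2, ← hα', restrictDeg_apply]
  rw [hpw, lmono, Units.coe_prod, ← Finset.prod_mul_prod_compl S, ← mul_assoc,
    ← Finset.prod_mul_distrib]
  refine B.mul_mem (B.prod_mem fun k hk => ?_) (B.prod_mem fun k hk => ?_)
  · rw [Units.val_zpow_eq_zpow_val, mul_pow, mul_assoc]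
    refine B.mul_mem (B.pow_mem (hB'' k hk) _) ?_
    rw [← zpow_natCast, ← zpow_add₀ (Units.ne_zero _),
      show ((-α k).toNat : ℤ) + α k = ((α k).toNat : ℤ) by omega, zpow_natCast]
    exact B.pow_mem (hB k) _
  · rw [Units.val_zpow_eq_zpow_val]
    rcases Int.eq_nat_or_neg (α k) with ⟨n, hn | hn⟩
    · rw [hn, zpow_natCast]
      exact B.pow_mem (hB k) n
    · rw [hn, zpow_neg, zpow_natCast, ← inv_pow]
      exact B.pow_mem (hB' k (Finset.mem_compl.1 hk)) n

end Flip

/-! ### Two successive exchanges: the non-adjacent and the adjacent case. -/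

section LaurentStep

variable {V : Type*} [Fintype V] [DecidableEq V] {F : Type*} [Field F] [Algebra ℚ F]

omit [DecidableEq V] [Algebra ℚ F] in
theorem lmono_nsmul (a : V → Fˣ) (n : ℕ) (α : V → ℤ) : lmono a (n • α) = lmono a α ^ n := by
  rw [← natCast_zsmul, lmono_zsmul, zpow_natCast]

omit [DecidableEq V] in
theorem leval_exch (a : V → Fˣ) (q : V → ℤ) :
    leval a (exch q) = (lmono a q⁺ : F) + lmono a q⁻ := by
  simp [exch, leval_mon]

omit [DecidableEq V] in
theorem leval_exch' (a : V → Fˣ) (q : V → ℤ) :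
    leval a (exch q) = (lmono a q⁻ : F) * (1 + lmono a q) := by
  simp [exch_eq, leval_mon, add_comm]

omit [DecidableEq V] in
theorem exch_ne_zero (q : V → ℤ) : exch q ≠ 0 := fun h => by
  have h1 := leval_exch (F := ℚ) (1 : V → ℚˣ) q
  rw [h, map_zero] at h1
  norm_num [lmono] at h1

/-- Since `v j = P / d`, the only new denominators are powers of `P`. -/
theorem exists_pow_mul_mem_laur_update {v : V → Fˣ} {j : V} {d : Fˣ} {P : LaurentRing V}
    (hd : (d : F) * v j = leval (Function.update v j d) P) {f : F} (hf : f ∈ laur v) :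
    ∃ N : ℕ, leval (Function.update v j d) P ^ N * f ∈ laur (Function.update v j d) := by
  set w := Function.update v j d with hw
  have hwj : w j = d := by simp [hw]
  have hwx : ∀ x, x ≠ j → w x = v x := fun x hx => by simp [hw, hx]
  have hP := leval_mem_laur w P
  refine exists_pow_mul_mem_of_mem_laur hP (fun x => ?_) (fun x => ?_) hf
  · by_cases hx : x = j
    · subst hx
      have := mul_mem hP (inv_apply_mem_laur w x)
      rwa [← hd, hwj, mul_comm, inv_mul_cancel_left₀ d.ne_zero] at this
    · rw [← hwx x hx]; exact apply_mem_laur w x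
  · by_cases hx : x = j
    · subst hx
      rw [← hd, mul_assoc, mul_inv_cancel₀ (Units.ne_zero _), mul_one, ← hwj]
      exact apply_mem_laur w x
    · rw [← hwx x hx]; exact mul_mem hP (inv_apply_mem_laur w x)

/-- Relative to the final cluster, `f` has a power of `exch r` as denominator when read in the
cluster exchanged at `i`, and a power of `mon q + 1` when read in the one exchanged at `j`. The
weight `x` makes these two coprime. -/
theorem mem_laur_update_update_of_eq_zero {a : V → Fˣ} {i j : V} (hij : i ≠ j) {ci cj : Fˣ}
    {q r x : V → ℤ} (hqi : q i = 0) (hqj : q j = 0) (hri : r i = 0) (hrj : r j = 0)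
    (hrx : r ⬝ᵥ x = 0) (hqx : q ⬝ᵥ x ≠ 0)
    (hci : (ci : F) * a i = leval a (exch q)) (hcj : (cj : F) * a j = leval a (exch r))
    (hw : Function.Injective (leval (Function.update (Function.update a i ci) j cj)))
    {f : F} (hf : f ∈ laur (Function.update a i ci)) (hf' : f ∈ laur (Function.update a j cj)) :
    f ∈ laur (Function.update (Function.update a i ci) j cj) := by
  set v := Function.update a i ci with hv
  set w := Function.update v j cj with hwdef
  have hwi : w i = ci := by simp [hwdef, hv, hij]
  have hwj : w j = cj := by simp [hwdef]
  have hlw : ∀ α : V → ℤ, α i = 0 → α j = 0 → lmono w α = lmono a α := fun α h1 h2 => by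
    rw [hwdef, lmono_update_of_eq_zero _ _ _ h2, hv, lmono_update_of_eq_zero _ _ _ h1]
  have hqw : lmono w q⁻ = lmono a q⁻ :=
    hlw _ (negPart_apply_eq_zero hqi) (negPart_apply_eq_zero hqj)
  obtain ⟨N, hN⟩ := exists_pow_mul_mem_laur_update (v := v) (j := j) (d := cj) (P := exch r) (by
    rw [leval_update_of_mem_zero _ _ _ (exch_mem_coordDeg hrj), hv,
      leval_update_of_mem_zero _ _ _ (exch_mem_coordDeg hri), ← hcj]
    simp [hij.symm]) hf
  have hD : leval w (mon q + 1) = 1 + (lmono a q : F) := by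
    rw [map_add, map_one, leval_mon, hlw q hqi hqj, add_comm]
  have hai : (ci : F) * a i = lmono w q⁻ * leval w (mon q + 1) := by
    rw [hci, leval_exch', hD, hqw]
  have hDm := leval_mem_laur w (mon q + 1)
  suffices hM : ∃ M : ℕ, leval w (mon q + 1) ^ M * f ∈ laur w by
    obtain ⟨M, hM⟩ := hM
    exact mem_laur_of_regMod hw (exch_ne_zero r) (regMod_mon_add_one_exch hrx hqx) hN hM
  refine exists_pow_mul_mem_of_mem_laur hDm (c := Function.update a j cj)
    (fun y => ?_) (fun y => ?_) hf'
  · by_cases hyj : y = j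
    · subst hyj; rw [Function.update_self, ← hwj]; exact apply_mem_laur w y
    rw [Function.update_of_ne hyj]
    by_cases hyi : y = i
    · subst hyi
      have : (a y : F) = (w y : F)⁻¹ * (lmono w q⁻ * leval w (mon q + 1)) := by
        rw [← hai, hwi, inv_mul_cancel_left₀ ci.ne_zero]
      rw [this]
      exact mul_mem (inv_apply_mem_laur w y) (mul_mem (lmono_mem_laur w _) hDm)
    · have : w y = a y := by simp [hwdef, hv, hyi, hyj]
      rw [← this]; exact apply_mem_laur w y
  · by_cases hyj : y = j
    · subst hyj; rw [Function.update_self, ← hwj]; exact mul_mem hDm (inv_apply_mem_laur w y)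
    rw [Function.update_of_ne hyj]
    by_cases hyi : y = i
    · subst hyi
      have : leval w (mon q + 1) * (a y : F)⁻¹ = (w y : F) * lmono w (-q⁻) := by
        rw [lmono_neg, Units.val_inv_eq_inv_val, hwi]
        field_simp
        linear_combination -hai
      rw [this]
      exact mul_mem (apply_mem_laur w y) (lmono_mem_laur w _)
    · have : w y = a y := by simp [hwdef, hv, hyi, hyj]
      rw [← this]; exact mul_mem hDm (inv_apply_mem_laur w y)

/-- The strategy is the same as for non-adjacent vertices, with denominators `P = exch r'` and `h *
G`, where `h` evaluates to `1 + a^q` and `G` to `cj` times a Laurent monomial. Here coprimality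
needs no rank condition. -/
theorem mem_laur_update_update_of_pos {a : V → Fˣ} {i j : V} (hij : i ≠ j) {ci cj dj : Fˣ}
    {q r r' : V → ℤ} {b : ℕ} (hb : b ≠ 0) (hqi : q i = 0) (hqj : q j = b) (hri : r i = -b)
    (hrj : r j = 0) (hr' : r' = r - b • q⁻ + (Pi.single i (b : ℤ) + Pi.single i (b : ℤ)))
    (hci : (ci : F) * a i = leval a (exch q)) (hcj : (cj : F) * a j = leval a (exch r))
    (hdj : (dj : F) * a j = leval (Function.update a i ci) (exch r'))
    (hw : Function.Injective (leval (Function.update (Function.update a i ci) j dj)))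
    {f : F} (hf : f ∈ laur (Function.update a i ci)) (hf' : f ∈ laur (Function.update a j cj)) :
    f ∈ laur (Function.update (Function.update a i ci) j dj) := by
  set v := Function.update a i ci with hv
  set w := Function.update v j dj with hwdef
  have hwi : w i = ci := by simp [hwdef, hv, hij]
  have hwj : w j = dj := by simp [hwdef]
  have hqni : q⁻ i = 0 := negPart_apply_eq_zero hqi
  have hqnj : q⁻ j = 0 := by simp [Pi.negPart_apply, hqj]
  have hr'j : r' j = 0 := by simp [hr', hrj, hqnj, hij]
  have hr'i : r' i = b := by simp [hr', hri, hqni]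
  have hlw : ∀ α : V → ℤ, α i = 0 → α j = 0 → lmono w α = lmono a α := fun α h1 h2 => by
    rw [hwdef, lmono_update_of_eq_zero _ _ _ h2, hv, lmono_update_of_eq_zero _ _ _ h1]
  have hqw : lmono w q⁻ = lmono a q⁻ := hlw _ hqni hqnj
  set P := exch r' with hPdef
  have hP : leval w P = (dj : F) * a j := by
    rw [hdj, hwdef, leval_update_of_mem_zero _ _ _ (exch_mem_coordDeg hr'j)]
  obtain ⟨N, hN⟩ := exists_pow_mul_mem_laur_update (v := v) (j := j) (d := dj) (P := P) (by
    rw [← hwdef, hP, hv, Function.update_of_ne hij.symm]) hf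
  -- the variable `a j` as a Laurent polynomial in `w`
  set A : LaurentRing V := P * mon (-Pi.single j 1) with hA
  have hAw : leval w A = a j := by
    rw [hA, map_mul, hP, leval_mon, lmono_neg, lmono_single, hwj, zpow_one,
      Units.val_inv_eq_inv_val]
    field_simp
  set n : V → ℤ := q - Pi.single j (b : ℤ) with hn
  have hnj : n j = 0 := by simp [hn, hqj]
  have hni : n i = 0 := by simp [hn, hqi, hij.symm]
  have hY : (lmono a q : F) = lmono a n * (a j : F) ^ b := by
    rw [hn, lmono_sub, lmono_single, zpow_natCast, ← Units.val_pow_eq_pow_val, ← Units.val_mul,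
      div_mul_cancel]
  set h : LaurentRing V := 1 + mon n * A ^ b with hh
  have hhw : leval w h = 1 + (lmono a q : F) := by
    rw [hh, map_add, map_one, map_mul, map_pow, hAw, leval_mon, hlw n hni hnj, hY]
  set H : Fˣ := ci * a i / lmono a q⁻ with hH
  have hHw : (H : F) = 1 + (lmono a q : F) := by
    rw [hH, Units.val_div_eq_div_val, Units.val_mul, hci, leval_exch']
    field_simp
  -- One has `cj μ a_j = (1 + a^r) H^b = (1 + v^{r'}) + (H^b - 1)`. The first summand is `dj a_j` up
  -- to a monomial, the second has the factor `a_j` by a geometric sum; division by `a_j` gives `G`.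
  set G : LaurentRing V :=
    mon (Pi.single j 1 - r'⁻) + mon n * A ^ (b - 1) * ∑ l ∈ Finset.range b, h ^ l with hG
  set μ : Fˣ := H ^ b / lmono a r⁻ with hμ
  have hμw : μ = lmono w (Pi.single i (b : ℤ) + Pi.single i (b : ℤ) - b • q⁻ - r⁻) := by
    have h1 : r⁻ i = b := by simp [Pi.negPart_apply, hri]
    have h2 : r⁻ j = 0 := negPart_apply_eq_zero hrj
    rw [hwdef, lmono_update_of_eq_zero _ _ _ (by simp [hij, hqnj, h2]), hv, lmono_update, hμ,
      hH, show (Pi.single i (b : ℤ) + Pi.single i (b : ℤ) - b • q⁻ - r⁻ : V → ℤ) i = b by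
        simp [hqni, h1], lmono_sub, lmono_sub, lmono_add, lmono_single, lmono_nsmul, zpow_natCast,
      zpow_natCast]
    ext
    push_cast
    simp only [div_pow, mul_pow]
    field_simp
  have hvr' : (lmono v r' : F) = lmono a r * (1 + lmono a q) ^ b := by
    rw [← hHw, hv, lmono_update, hr'i, hr', lmono_add, lmono_sub, lmono_add, lmono_single,
      lmono_nsmul, zpow_natCast, zpow_natCast, hH]
    push_cast
    simp only [div_pow, mul_pow]
    field_simp
  have hGw : leval w G = cj * μ := by
    have haj : (a j : F) ≠ 0 := Units.ne_zero _
    refine mul_right_cancel₀ haj ?_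
    have e1 : (cj : F) * μ * a j = (1 + lmono a r) * (1 + lmono a q) ^ b := by
      rw [mul_right_comm, hcj, leval_exch', hμ, Units.val_div_eq_div_val, Units.val_pow_eq_pow_val,
        hHw]
      field_simp
    have e2 : leval w (mon (Pi.single j 1 - r'⁻)) * a j = 1 + lmono v r' := by
      have h1 : lmono w r'⁻ = lmono v r'⁻ := by
        rw [hwdef, lmono_update_of_eq_zero _ _ _ (negPart_apply_eq_zero hr'j)]
      rw [leval_mon, lmono_sub, lmono_single, zpow_one, hwj, Units.val_div_eq_div_val, h1,
        div_mul_eq_mul_div, hdj, leval_exch']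
      field_simp
    have e3 : leval w (mon n * A ^ (b - 1) * ∑ l ∈ Finset.range b, h ^ l) * a j =
        (1 + lmono a q) ^ b - 1 := by
      have h1 := geom_sum_mul (1 + (lmono a q : F)) b
      rw [add_sub_cancel_left] at h1
      rw [← h1, map_mul, map_mul, map_pow, hAw, leval_mon, hlw n hni hnj, map_sum]
      simp only [map_pow, hhw]
      rw [hY]
      obtain ⟨b', rfl⟩ := Nat.exists_eq_succ_of_ne_zero hb
      simp only [Nat.succ_eq_add_one, Nat.add_sub_cancel]
      ring
    rw [hG, map_add, add_mul, e1, e2, e3, hvr']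
    ring
  have hGm := leval_mem_laur w G
  have hhm := leval_mem_laur w h
  have hμm : (μ : F) ∈ laur w := by rw [hμw]; exact lmono_mem_laur w _
  have hμm' : (μ : F)⁻¹ ∈ laur w := by
    rw [← Units.val_inv_eq_inv_val, hμw, ← lmono_neg]; exact lmono_mem_laur w _
  have hDm := leval_mem_laur w (h * G)
  have hHi : (ci : F) * a i = lmono w q⁻ * leval w h := by
    rw [hci, leval_exch', hhw, hqw]
  -- `A` is a multiple of `P`, so modulo `P` the element `h` is `1` and, if `b ≥ 2`, `G` is a
  -- monomial. If `b = 1`, `G` is a sum of monomials of degrees `1` and `0` in the variable `j`, and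
  -- `P` has degree `0`.
  have hreg : RegMod (h * G) P := by
    obtain ⟨b', rfl⟩ := Nat.exists_eq_succ_of_ne_zero hb
    refine RegMod.mul_left ?_ ?_
    · have : h = 1 + P * (mon (-Pi.single j 1) * (mon n * A ^ b')) := by
        rw [hh, pow_succ, hA]; ring
      rw [this]
      exact (RegMod.one_left P).add_mul _
    · rcases Nat.eq_zero_or_pos b' with rfl | hb'
      · have : G = mon (Pi.single j 1 - r'⁻) + mon n := by simp [hG]
        rw [this]
        refine regMod_add_of_graded (AddMonoidAlgebra.gradeBy ℚ (coordDeg j)) (e := 1) one_ne_zero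
          (exch_mem_coordDeg hr'j) (mon_mem_gradeBy_of_eq _ ?_) (isUnit_mon _)
          (mon_mem_gradeBy_of_eq _ hnj)
        simp [negPart_apply_eq_zero hr'j]
      · obtain ⟨b'', rfl⟩ := Nat.exists_eq_succ_of_ne_zero hb'.ne'
        have : G = mon (Pi.single j 1 - r'⁻) + P * (mon (-Pi.single j 1) * (mon n * A ^ b'' *
            ∑ l ∈ Finset.range (b'' + 1 + 1), h ^ l)) := by
          rw [hG]
          simp only [Nat.succ_eq_add_one, Nat.add_sub_cancel]
          rw [pow_succ]
          nth_rewrite 2 [hA]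
          ring
        rw [this]
        exact (RegMod.of_isUnit (isUnit_mon _) P).add_mul _
  suffices hM : ∃ M : ℕ, leval w (h * G) ^ M * f ∈ laur w by
    obtain ⟨M, hM⟩ := hM
    exact mem_laur_of_regMod hw (exch_ne_zero r') hreg hN hM
  refine exists_pow_mul_mem_of_mem_laur hDm (c := Function.update a j cj)
    (fun y => ?_) (fun y => ?_) hf'
  · by_cases hyj : y = j
    · subst hyj
      have := mul_mem hGm hμm'
      rwa [hGw, mul_assoc, mul_inv_cancel₀ μ.ne_zero, mul_one, ← Function.update_self y cj a]
        at this
    rw [Function.update_of_ne hyj]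
    by_cases hyi : y = i
    · subst hyi
      have : (a y : F) = (w y : F)⁻¹ * (lmono w q⁻ * leval w h) := by
        rw [← hHi, hwi, inv_mul_cancel_left₀ ci.ne_zero]
      rw [this]
      exact mul_mem (inv_apply_mem_laur w y) (mul_mem (lmono_mem_laur w _) hhm)
    · have : w y = a y := by simp [hwdef, hv, hyi, hyj]
      rw [← this]; exact apply_mem_laur w y
  · by_cases hyj : y = j
    · subst hyj
      rw [Function.update_self, map_mul, hGw,
        show leval w h * ((cj : F) * μ) * (cj : F)⁻¹ = leval w h * μ by field_simp]
      exact mul_mem hhm hμm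
    rw [Function.update_of_ne hyj]
    by_cases hyi : y = i
    · subst hyi
      have : leval w (h * G) * (a y : F)⁻¹ = (w y : F) * lmono w (-q⁻) * leval w G := by
        rw [lmono_neg, Units.val_inv_eq_inv_val, hwi, map_mul]
        field_simp
        linear_combination -(leval w G) * hHi
      rw [this]
      exact mul_mem (mul_mem (apply_mem_laur w y) (lmono_mem_laur w _)) hGm
    · have : w y = a y := by simp [hwdef, hv, hyi, hyj]
      rw [← this]; exact mul_mem hDm (inv_apply_mem_laur w y)

end LaurentStep

/-! ### Mutation of matrices and invariance of full rank. -/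

section Quiver

variable {V : Type*} [DecidableEq V]

omit [DecidableEq V] in
theorem IceQuiver.mat_self (Q : IceQuiver V) (i : V) : Q.mat i i = 0 := by
  have := Q.skew i i
  omega

theorem IceQuiver.mutate_mat_self_left (Q : IceQuiver V) (k : V) :
    (Q.mutate k).mat k = -Q.mat k := by
  ext j; simp [IceQuiver.mutate]

theorem IceQuiver.mutate_mat_self_right (Q : IceQuiver V) (i k : V) :
    (Q.mutate k).mat i k = -Q.mat i k := by
  simp [IceQuiver.mutate]

/-- Writing `x = x⁺ - x⁻` and `|x| = x⁺ + x⁻` makes the sum in the mutation rule visibly even. -/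
theorem IceQuiver.mutate_mat_of_ne (Q : IceQuiver V) {i j k : V} (hi : i ≠ k) (hj : j ≠ k) :
    (Q.mutate k).mat i j =
      Q.mat i j + ((Q.mat i k)⁻ * Q.mat k j + Q.mat i k * (Q.mat k j)⁺) := by
  simp only [IceQuiver.mutate, hi, hj, or_self, if_false]
  congr 1
  have h1 := posPart_add_negPart (Q.mat i k)
  have h2 := posPart_sub_negPart (Q.mat i k)
  have h3 := posPart_add_negPart (Q.mat k j)
  have h4 := posPart_sub_negPart (Q.mat k j)
  refine Int.ediv_eq_of_eq_mul_right two_ne_zero ?_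
  linear_combination (-Q.mat k j) * h1 + (-Q.mat i k) * h3 + Q.mat k j * h2 - Q.mat i k * h4

/-- The quiver with all arrows reversed. -/
def IceQuiver.opposite (Q : IceQuiver V) : IceQuiver V where
  mat := -Q.mat
  skew i j := congrArg Neg.neg (Q.skew i j)
  frozen := Q.frozen

/-- Exchange polynomials do not see the reversal of all arrows, so this reduces a negative entry
`Q.mat i j` to a positive one. -/
theorem IceQuiver.opposite_mutate_mat (Q : IceQuiver V) (i j : V) :
    (Q.opposite.mutate i).mat j = -(Q.mutate i).mat j := by
  ext l
  by_cases hj : j = i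
  · subst hj
    simp [mutate_mat_self_left, opposite]
  by_cases hl : l = i
  · subst hl
    simp [mutate_mat_self_right, opposite]
  rw [mutate_mat_of_ne _ hj hl, Pi.neg_apply, mutate_mat_of_ne _ hj hl]
  simp only [opposite, Matrix.neg_apply, posPart_neg, negPart_neg]
  linear_combination (-Q.mat i l) * posPart_sub_negPart (Q.mat j i) +
    Q.mat j i * posPart_sub_negPart (Q.mat i l)

theorem IceQuiver.mutate_mat_of_nonpos (Q : IceQuiver V) {i j : V} (hij : i ≠ j) {b : ℕ}
    (hb : Q.mat j i = -b) :
    (Q.mutate i).mat j =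
      Q.mat j - b • (Q.mat i)⁻ + (Pi.single i (b : ℤ) + Pi.single i (b : ℤ)) := by
  ext l
  by_cases hl : l = i
  · subst hl
    simp [mutate_mat_self_right, hb, Pi.negPart_apply, mat_self]
  · rw [mutate_mat_of_ne _ hij.symm hl, hb]
    have h4 := posPart_sub_negPart (Q.mat i l)
    simp [hl, Pi.negPart_apply]
    nth_rewrite 1 [← h4]
    ring

variable [Fintype V]

omit [DecidableEq V] in
theorem IceQuiver.FullRank.exists_rat {Q : IceQuiver V} (hQ : Q.FullRank) (y : V → ℚ) :
    ∃ x : V → ℚ, ∀ i ∉ Q.frozen, ∑ j, (Q.mat i j : ℚ) * x j = y i := by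
  obtain ⟨x, hx⟩ := hQ fun i => y i
  exact ⟨x, fun i hi => congrFun hx ⟨i, hi⟩⟩

omit [DecidableEq V] in
theorem IceQuiver.fullRank_of_exists {Q : IceQuiver V}
    (h : ∀ y : V → ℚ, ∃ x : V → ℚ, ∀ i ∉ Q.frozen, ∑ j, (Q.mat i j : ℚ) * x j = y i) :
    Q.FullRank := by
  intro y
  classical
  obtain ⟨x, hx⟩ := h fun i => if hi : i ∉ Q.frozen then y ⟨i, hi⟩ else 0
  refine ⟨x, funext fun i => ?_⟩
  have := hx i i.2
  rw [dif_pos i.2] at this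
  exact this

/-- Supplies the weights that separate exchange polynomials: a rational preimage of a basis vector,
with denominators cleared. -/
theorem IceQuiver.FullRank.exists_int {Q : IceQuiver V} (hQ : Q.FullRank) {k : V}
    (hk : k ∉ Q.frozen) :
    ∃ x : V → ℤ, Q.mat k ⬝ᵥ x ≠ 0 ∧ ∀ i ∉ Q.frozen, i ≠ k → Q.mat i ⬝ᵥ x = 0 := by
  obtain ⟨x, hx⟩ := hQ.exists_rat (Pi.single k 1)
  obtain ⟨⟨D, hD⟩, hx'⟩ := IsLocalization.exist_integer_multiples_of_finset (nonZeroDivisors ℤ)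
    (Finset.univ.image x)
  have hD0 : D ≠ 0 := nonZeroDivisors.ne_zero hD
  choose z hz using fun j => hx' (x j) (Finset.mem_image_of_mem x (Finset.mem_univ j))
  have key : ∀ i ∉ Q.frozen, ((Q.mat i ⬝ᵥ z : ℤ) : ℚ) = D * (Pi.single k 1 : V → ℚ) i := by
    intro i hi
    rw [← hx i hi, dotProduct, Int.cast_sum, Finset.mul_sum]
    refine Finset.sum_congr rfl fun j _ => ?_
    have hzj : (z j : ℚ) = D * x j := by
      have := hz j
      rwa [zsmul_eq_mul, eq_intCast] at this
    rw [Int.cast_mul, hzj]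
    ring
  refine ⟨z, fun h => ?_, fun i hi hik => ?_⟩
  · have := key k hk
    rw [h] at this
    simp only [Int.cast_zero, Pi.single_eq_same, mul_one] at this
    exact hD0 (by exact_mod_cast this.symm)
  · have := key i hi
    simpa [hik] using this

/-- Mutation multiplies the exchange matrix by invertible matrices on both sides. The row operation
acts on the right-hand side `y`, the column operation replaces `x k` by `c`. -/
theorem IceQuiver.FullRank.mutate {Q : IceQuiver V} (hQ : Q.FullRank) {k : V}
    (hk : k ∉ Q.frozen) : (Q.mutate k).FullRank := by
  refine fullRank_of_exists fun y => ?_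
  obtain ⟨x, hx⟩ := hQ.exists_rat fun i =>
    if i = k then -y k else y i + (((Q.mat i k)⁻ : ℤ) : ℚ) * y k
  set c : ℚ := -x k + ∑ j, (((Q.mat k j)⁺ : ℤ) : ℚ) * x j with hc
  refine ⟨Function.update x k c, fun i hi => ?_⟩
  have hxk := hx k hk
  rw [if_pos rfl] at hxk
  have hkk : Q.mat k k = 0 := Q.mat_self k
  by_cases hik : i = k
  · subst hik
    rw [← neg_eq_iff_eq_neg.2 hxk, ← Finset.sum_neg_distrib]
    refine Finset.sum_congr rfl fun j _ => ?_
    rw [Q.mutate_mat_self_left]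
    by_cases hj : j = i
    · subst hj; simp [hkk]
    · simp [hj]
  · have hxi := hx i hi
    rw [if_neg hik] at hxi
    rw [← Finset.add_sum_erase _ _ (Finset.mem_univ k)] at hxi hxk ⊢
    have hsum : ∑ j ∈ Finset.univ.erase k, ((Q.mutate k).mat i j : ℚ) * Function.update x k c j =
        ∑ j ∈ Finset.univ.erase k, ((Q.mat i j : ℚ) * x j +
          ((((Q.mat i k)⁻ : ℤ) : ℚ) * ((Q.mat k j : ℚ) * x j) +
            (Q.mat i k : ℚ) * ((((Q.mat k j)⁺ : ℤ) : ℚ) * x j))) := by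
      refine Finset.sum_congr rfl fun j hj => ?_
      have hj := Finset.ne_of_mem_erase hj
      rw [Function.update_of_ne hj, Q.mutate_mat_of_ne hik hj]
      push_cast
      ring
    rw [hsum, Finset.sum_add_distrib, Finset.sum_add_distrib, ← Finset.mul_sum, ← Finset.mul_sum,
      Function.update_self, Q.mutate_mat_self_right, hc,
      ← Finset.add_sum_erase _ (fun j => (((Q.mat k j)⁺ : ℤ) : ℚ) * x j) (Finset.mem_univ k)]
    rw [hkk] at hxk ⊢
    push_cast at hxk ⊢
    rw [posPart_zero, Int.cast_zero]
    linear_combination hxi + (((Q.mat i k)⁻ : ℤ) : ℚ) * hxk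

end Quiver

/-! ### Two successive exchanges in a quiver of full rank. -/

section LaurentStep

variable {V : Type*} [Fintype V] [DecidableEq V] {F : Type*} [Field F] [Algebra ℚ F]

/-- Full rank matters only when `i` and `j` are not adjacent: the row of `j` is then unchanged by
the mutation at `i`, and a weight has to tell the two exchange polynomials apart. -/
theorem IceQuiver.FullRank.mem_laur_update_update {Q : IceQuiver V} (hQ : Q.FullRank)
    {a : V → Fˣ} {i j : V} (hij : i ≠ j) (hi : i ∉ Q.frozen) (hj : j ∉ Q.frozen) {ci cj dj : Fˣ}
    (hci : (ci : F) * a i = leval a (exch (Q.mat i)))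
    (hcj : (cj : F) * a j = leval a (exch (Q.mat j)))
    (hdj : (dj : F) * a j = leval (Function.update a i ci) (exch ((Q.mutate i).mat j)))
    (hw : Function.Injective (leval (Function.update (Function.update a i ci) j dj)))
    {f : F} (hf : f ∈ laur (Function.update a i ci)) (hf' : f ∈ laur (Function.update a j cj)) :
    f ∈ laur (Function.update (Function.update a i ci) j dj) := by
  rcases lt_trichotomy (Q.mat i j) 0 with h | h | h
  · obtain ⟨b, hb⟩ := Int.exists_eq_neg_ofNat h.le
    refine mem_laur_update_update_of_pos (q := Q.opposite.mat i) (r := Q.opposite.mat j)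
      (r' := (Q.opposite.mutate i).mat j) (b := b) hij (by omega) ?_ ?_ ?_ ?_ ?_ ?_ ?_ ?_ hw hf hf'
    · simp [opposite, Q.mat_self]
    · simp [opposite, hb]
    · simp [opposite, Q.skew j i, hb]
    · simp [opposite, Q.mat_self]
    · exact Q.opposite.mutate_mat_of_nonpos hij (by simp [opposite, Q.skew j i, hb])
    · rw [hci, ← exch_neg]; rfl
    · rw [hcj, ← exch_neg]; rfl
    · rw [hdj, Q.opposite_mutate_mat, exch_neg]
  · have h' : Q.mat j i = 0 := by rw [Q.skew, h, neg_zero]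
    have hr : (Q.mutate i).mat j = Q.mat j := by
      rw [Q.mutate_mat_of_nonpos (b := 0) hij (by simpa using h')]
      simp
    have : dj = cj := by
      rw [hr, leval_update_of_mem_zero _ _ _ (exch_mem_coordDeg h'), ← hcj] at hdj
      exact Units.ext (mul_right_cancel₀ (Units.ne_zero _) hdj)
    subst this
    obtain ⟨x, hx, hx'⟩ := hQ.exists_int hi
    exact mem_laur_update_update_of_eq_zero hij (Q.mat_self i) h h' (Q.mat_self j)
      (hx' j hj hij.symm) hx hci hcj hw hf hf'
  · obtain ⟨b, hb⟩ := Int.eq_ofNat_of_zero_le h.le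
    exact mem_laur_update_update_of_pos (b := b) hij (by omega) (Q.mat_self i) hb
      (by rw [Q.skew, hb]) (Q.mat_self j)
      (Q.mutate_mat_of_nonpos hij (by rw [Q.skew, hb])) hci hcj hdj hw hf hf'

end LaurentStep

/-! ### Seeds, upper bounds and the Laurent phenomenon. -/

section

variable {V : Type*} [Fintype V] [DecidableEq V]

omit [DecidableEq V] in
theorem lmono_posPart {F : Type*} [Field F] (a : V → Fˣ) (q : V → ℤ) :
    (lmono a q⁺ : F) = ∏ j with 0 < q j, (a j : F) ^ (q j).toNat := by
  rw [lmono, Units.coe_prod, Finset.prod_filter]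
  refine Finset.prod_congr rfl fun j _ => ?_
  split_ifs with h
  · rw [Pi.posPart_apply, posPart_of_nonneg h.le, Units.val_zpow_eq_zpow_val, ← zpow_natCast,
      Int.toNat_of_nonneg h.le]
  · rw [Pi.posPart_apply, posPart_of_nonpos (not_lt.1 h), zpow_zero, Units.val_one]

omit [DecidableEq V] in
theorem lmono_negPart {F : Type*} [Field F] (a : V → Fˣ) (q : V → ℤ) :
    (lmono a q⁻ : F) = ∏ j with q j < 0, (a j : F) ^ (-q j).toNat := by
  have := lmono_posPart a (-q)
  rw [posPart_neg] at this
  simpa using this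

/-- A monomial clears the denominators of a Laurent polynomial, so a Laurent relation would give a
polynomial one. -/
theorem leval_injective_of_algebraicIndependent {F : Type*} [Field F] [Algebra ℚ F] {a : V → Fˣ}
    (h : AlgebraicIndependent ℚ fun v => (a v : F)) : Function.Injective (leval a) := by
  let T : MvPolynomial V ℚ →ₐ[ℚ] LaurentRing V := MvPolynomial.aeval fun v => mon (Pi.single v 1)
  have hT : ∀ g, leval a (T g) = MvPolynomial.aeval (fun v => (a v : F)) g := fun g => by
    rw [← AlgHom.comp_apply]
    congr 1
    ext v
    simp [T, leval_mon, lmono_single]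
  have hpow : ∀ α : V → ℤ, mon α⁺ ∈ T.range := fun α => by
    have : (α⁺ : V → ℤ) = ∑ v, ((α v).toNat) • (Pi.single v 1 : V → ℤ) := by
      ext w
      simp [Finset.sum_apply, Pi.single_apply, Pi.posPart_apply, posPart_def]
    rw [this]
    refine Finset.sum_induction _ (fun β => mon β ∈ T.range) (fun β γ hβ hγ => ?_)
      (by rw [mon_zero]; exact one_mem _) fun v _ => ?_
    · rw [mon_add]; exact mul_mem hβ hγ
    · induction (α v).toNat with
      | zero => rw [zero_smul, mon_zero]; exact one_mem _
      | succ n ih =>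
        rw [succ_nsmul, mon_add]
        exact mul_mem ih ⟨MvPolynomial.X v, by simp [T]⟩
  have hclear : ∀ f : LaurentRing V, ∃ α : V → ℤ, mon α⁺ * f ∈ T.range := fun f => by
    induction f using AddMonoidAlgebra.induction_linear with
    | zero => exact ⟨0, by simp⟩
    | add f g hf hg =>
      obtain ⟨α, hα⟩ := hf
      obtain ⟨β, hβ⟩ := hg
      refine ⟨α⁺ + β⁺, ?_⟩
      have h0 : (α⁺ + β⁺)⁺ = α⁺ + β⁺ :=
        posPart_of_nonneg (add_nonneg (posPart_nonneg α) (posPart_nonneg β))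
      rw [h0, mon_add, show mon α⁺ * mon β⁺ * (f + g) =
        mon β⁺ * (mon α⁺ * f) + mon α⁺ * (mon β⁺ * g) by ring]
      exact add_mem (mul_mem (hpow β) hα) (mul_mem (hpow α) hβ)
    | single α r =>
      refine ⟨-α, ?_⟩
      rw [single_eq_smul_mon, mul_smul_comm, ← mon_add, posPart_neg, add_comm,
        ← sub_eq_iff_eq_add.1 (posPart_sub_negPart α)]
      exact T.range.smul_mem (hpow α) r
  rw [injective_iff_map_eq_zero]
  intro f hf
  obtain ⟨α, g, hg : T g = _⟩ := hclear f
  have h1 : MvPolynomial.aeval (fun v => (a v : F)) g = 0 := by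
    rw [← hT, hg, map_mul, hf, mul_zero]
  rw [(injective_iff_map_eq_zero _).1 h g h1, map_zero] at hg
  exact ((isUnit_mon _).mul_right_eq_zero).1 hg.symm

namespace Seed

/-- The elements of the cluster are the units `a v`, and they are algebraically independent. -/
def IsCluster (u : Seed V) (a : V → (RatFun V)ˣ) : Prop :=
  (∀ v, (a v : RatFun V) = u.cluster v) ∧ Function.Injective (leval a)

omit [DecidableEq V] in
theorem exists_exchange {F : Type*} [Field F] [Algebra ℚ F] {a : V → Fˣ}
    (ha : Function.Injective (leval a)) (q : V → ℤ) (k : V) :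
    ∃ c : Fˣ, (c : F) * a k = leval a (exch q) := by
  have h0 : leval a (exch q) ≠ 0 := by simpa using ha.ne (exch_ne_zero q)
  refine ⟨Units.mk0 _ h0 / a k, ?_⟩
  rw [← Units.val_mul, div_mul_cancel, Units.val_mk0]

theorem mutate_cluster_self {u : Seed V} {a : V → (RatFun V)ˣ} (ha : u.IsCluster a) (k : V) :
    (u.mutate k).cluster k = leval a (exch (u.quiver.mat k)) * (a k : RatFun V)⁻¹ := by
  rw [leval_exch, lmono_posPart, lmono_negPart]
  simp only [ha.1]
  simp [mutate]

theorem mutate_cluster_of_ne (u : Seed V) {k v : V} (h : v ≠ k) :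
    (u.mutate k).cluster v = u.cluster v := by
  simp [mutate, h]

theorem IsCluster.mutate {u : Seed V} {a : V → (RatFun V)ˣ} (ha : u.IsCluster a) {k : V}
    {c : (RatFun V)ˣ} (hc : (c : RatFun V) * a k = leval a (exch (u.quiver.mat k))) :
    (u.mutate k).IsCluster (Function.update a k c) := by
  refine ⟨fun v => ?_, leval_update_injective ha.2 hc
    (exch_mem_coordDeg (u.quiver.mat_self k))⟩
  by_cases hv : v = k
  · subst hv
    rw [mutate_cluster_self ha, Function.update_self, ← hc, mul_inv_cancel_right₀ (Units.ne_zero _)]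
  · rw [mutate_cluster_of_ne u hv, Function.update_of_ne hv, ha.1]

/-- Makes mutation sequences reversible. Both exchanges use the same polynomial, as the row of `k`
only changes sign and does not involve the variable `k`. -/
theorem IsCluster.mutate_mutate {u : Seed V} {a : V → (RatFun V)ˣ} (ha : u.IsCluster a) (k : V) :
    (u.mutate k).mutate k = u := by
  obtain ⟨c, hc⟩ := exists_exchange ha.2 (u.quiver.mat k) k
  have hq : (u.mutate k).quiver = u.quiver.mutate k := rfl
  refine Seed.ext (IceQuiver.ext ?_ rfl) (funext fun v => ?_)
  · ext i j
    change ((u.quiver.mutate k).mutate k).mat i j = _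
    by_cases hi : i = k
    · subst hi; simp [IceQuiver.mutate_mat_self_left]
    by_cases hj : j = k
    · subst hj; simp [IceQuiver.mutate_mat_self_right]
    rw [IceQuiver.mutate_mat_of_ne _ hi hj, IceQuiver.mutate_mat_self_left,
      IceQuiver.mutate_mat_self_right, IceQuiver.mutate_mat_of_ne _ hi hj, Pi.neg_apply,
      negPart_neg, posPart_neg]
    linear_combination (-u.quiver.mat k j) * posPart_sub_negPart (u.quiver.mat i k) +
      u.quiver.mat i k * posPart_sub_negPart (u.quiver.mat k j)
  · by_cases hv : v = k
    · subst hv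
      rw [mutate_cluster_self (ha.mutate hc), hq, IceQuiver.mutate_mat_self_left, exch_neg,
        leval_update_of_mem_zero _ _ _ (exch_mem_coordDeg (u.quiver.mat_self v)), ← hc,
        Function.update_self, ← ha.1]
      field_simp
    · rw [mutate_cluster_of_ne _ hv, mutate_cluster_of_ne _ hv]

theorem MutEquiv.exists_isCluster {s u : Seed V} (h : s.MutEquiv u)
    (hs : ∃ a, s.IsCluster a) (hr : s.quiver.FullRank) :
    (∃ a, u.IsCluster a) ∧ u.quiver.FullRank := by
  induction h with
  | refl => exact ⟨hs, hr⟩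
  | tail _ h ih =>
    obtain ⟨k, hk, rfl⟩ := h
    obtain ⟨⟨a, ha⟩, hr⟩ := ih
    obtain ⟨c, hc⟩ := exists_exchange ha.2 _ k
    exact ⟨⟨_, ha.mutate hc⟩, hr.mutate hk⟩

theorem MutEquiv.frozen_eq {s u : Seed V} (h : s.MutEquiv u) :
    u.quiver.frozen = s.quiver.frozen := by
  induction h with
  | refl => rfl
  | tail _ h ih =>
    obtain ⟨k, hk, rfl⟩ := h
    exact ih

theorem MutEquiv.cluster_eq {s u : Seed V} (h : s.MutEquiv u) {v : V}
    (hv : v ∈ s.quiver.frozen) : u.cluster v = s.cluster v := by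
  induction h with
  | refl => rfl
  | tail h1 h ih =>
    obtain ⟨k, hk, rfl⟩ := h
    rw [← ih, mutate_cluster_of_ne]
    rintro rfl
    exact hk (by rwa [MutEquiv.frozen_eq h1])

/-- Membership in the upper bound of a seed. -/
def InUpperBound (u : Seed V) (f : RatFun V) : Prop :=
  ∀ a, u.IsCluster a → f ∈ laur a ∧ ∀ k ∉ u.quiver.frozen, ∀ c : (RatFun V)ˣ,
    (c : RatFun V) * a k = leval a (exch (u.quiver.mat k)) → f ∈ laur (Function.update a k c)

/-- The exchange at `k` leads back to the old cluster. At `j ≠ k` the two-step lemma applies, since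
`f` is Laurent in the old cluster exchanged at `k` and in the one exchanged at `j`. -/
theorem InUpperBound.mutate {u : Seed V} (hr : u.quiver.FullRank) (hu : ∃ a, u.IsCluster a) {k : V}
    (hk : k ∉ u.quiver.frozen) {f : RatFun V} (hf : u.InUpperBound f) :
    (u.mutate k).InUpperBound f := by
  obtain ⟨a, ha⟩ := hu
  obtain ⟨c, hc⟩ := exists_exchange ha.2 (u.quiver.mat k) k
  obtain ⟨hf1, hf2⟩ := hf a ha
  intro a' ha'
  obtain rfl : a' = Function.update a k c :=
    funext fun v => Units.ext (by rw [ha'.1, (ha.mutate hc).1])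
  refine ⟨hf2 k hk c hc, fun j hj d hd => ?_⟩
  change (d : RatFun V) * _ = leval _ (exch ((u.quiver.mutate k).mat j)) at hd
  by_cases hjk : j = k
  · subst hjk
    rw [IceQuiver.mutate_mat_self_left, exch_neg,
      leval_update_of_mem_zero _ _ _ (exch_mem_coordDeg (u.quiver.mat_self j)), ← hc,
      Function.update_self, mul_comm] at hd
    rw [Units.ext (mul_left_cancel₀ (Units.ne_zero _) hd)]
    simpa using hf1
  · obtain ⟨cj, hcj⟩ := exists_exchange ha.2 (u.quiver.mat j) j
    have hd' := hd
    rw [Function.update_of_ne hjk] at hd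
    exact hr.mem_laur_update_update (Ne.symm hjk) hk hj hc hcj hd
      (leval_update_injective ha'.2 hd'
        (exch_mem_coordDeg ((u.quiver.mutate k).mat_self j))) (hf2 k hk c hc) (hf2 j hj cj hcj)

theorem inUpperBound_cluster (u : Seed V) (v : V) : u.InUpperBound (u.cluster v) := by
  intro a ha
  refine ⟨by rw [← ha.1]; exact apply_mem_laur a v, fun k hk c hc => ?_⟩
  rw [← ha.1]
  by_cases hv : v = k
  · subst hv
    have : (a v : RatFun V) = (Function.update a v c v : RatFun V)⁻¹ *
        leval (Function.update a v c) (exch (u.quiver.mat v)) := by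
      rw [leval_update_of_mem_zero _ _ _ (exch_mem_coordDeg (u.quiver.mat_self v)), ← hc,
        Function.update_self, inv_mul_cancel_left₀ (Units.ne_zero c)]
    rw [this]
    exact mul_mem (inv_apply_mem_laur _ v) (leval_mem_laur _ _)
  · have := apply_mem_laur (Function.update a k c) v
    rwa [Function.update_of_ne hv] at this

theorem inUpperBound_cluster_inv (u : Seed V) {v : V} (hv : v ∈ u.quiver.frozen) :
    u.InUpperBound (u.cluster v)⁻¹ := by
  intro a ha
  rw [← ha.1]
  refine ⟨inv_apply_mem_laur a v, fun k hk c hc => ?_⟩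
  have := inv_apply_mem_laur (Function.update a k c) v
  have hvk : v ≠ k := by rintro rfl; exact hk hv
  rwa [Function.update_of_ne hvk] at this

theorem InUpperBound.of_mutEquiv {s u : Seed V} (h : s.MutEquiv u) (hs : ∃ a, s.IsCluster a)
    (hr : s.quiver.FullRank) {f : RatFun V} (hf : s.InUpperBound f) : u.InUpperBound f := by
  induction h with
  | refl => exact hf
  | tail h1 h ih =>
    obtain ⟨k, hk, rfl⟩ := h
    obtain ⟨hu, hr'⟩ := MutEquiv.exists_isCluster h1 hs hr
    exact ih.mutate hr' hu hk

theorem MutEquiv.symm {s u : Seed V} (h : s.MutEquiv u) (hs : ∃ a, s.IsCluster a)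
    (hr : s.quiver.FullRank) : u.MutEquiv s := by
  induction h with
  | refl => exact Relation.ReflTransGen.refl
  | tail h1 h ih =>
    obtain ⟨k, hk, rfl⟩ := h
    obtain ⟨⟨a, ha⟩, -⟩ := MutEquiv.exists_isCluster h1 hs hr
    exact Relation.ReflTransGen.head ⟨k, hk, (ha.mutate_mutate k).symm⟩ ih

/-- The Laurent phenomenon: the elements of a cluster algebra of full rank are in the upper bounds
of all of its seeds. -/
theorem inUpperBound_of_mem_clusterAlgebra {s u : Seed V} (h : s.MutEquiv u)
    (hs : ∃ a, s.IsCluster a) (hr : s.quiver.FullRank) {f : RatFun V}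
    (hf : f ∈ s.clusterAlgebra) : u.InUpperBound f := by
  have hsub : s.clusterAlgebra ≤ Subring.closure {f | u.InUpperBound f} := by
    refine Subring.closure_mono ?_
    rintro f (⟨t, hst, v, rfl⟩ | ⟨v, hv, rfl⟩)
    · obtain ⟨ht, hr'⟩ := hst.exists_isCluster hs hr
      exact InUpperBound.of_mutEquiv ((hst.symm hs hr).trans h) ht hr' (t.inUpperBound_cluster v)
    · exact InUpperBound.of_mutEquiv h hs hr (s.inUpperBound_cluster_inv hv)
  intro a ha
  -- An upper bound is an intersection of Laurent rings, so it suffices to test generators.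
  have key : ∀ B : Subalgebra ℚ (RatFun V), (∀ g, u.InUpperBound g → g ∈ B) → f ∈ B :=
    fun B hB => (Subring.closure_le (t := B.toSubring)).2 hB (hsub hf)
  exact ⟨key _ fun g hg => (hg a ha).1, fun k hk c hc => key _ fun g hg => (hg a ha).2 k hk c hc⟩

theorem cluster_mem_clusterAlgebra {s t : Seed V} (h : s.MutEquiv t) (v : V) :
    t.cluster v ∈ s.clusterAlgebra :=
  Subring.subset_closure (Or.inl ⟨t, h, v, rfl⟩)

end Seed

end

/-! ### Local models: independent sets of vertices and the points of acyclic charts. -/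

section

/-- Elements `γ` of a ring `A`, indexed by `V` and by a set `S` of pairwise non-adjacent vertices,
which satisfy the exchange relations at the vertices in `S` and generate `A` after inverting the
`γ v` with `v ∉ S` and the integers, and such that all nonzero values of the `γ v`, `v ∈ V`, are
attained at some `K`-point. -/
structure LocalModel {V : Type*} [Fintype V] [DecidableEq V] {A : Type*} [CommRing A] (K : Type*)
    [Field K] (S : Finset V) (q : V → V → ℤ) (γ : V ⊕ S → A) : Prop where
  eq_zero : ∀ i ∈ S, ∀ j ∈ S, q i j = 0
  rank : ∀ y : V → ℚ, ∃ x : V → ℚ, ∀ i ∈ S, ∑ j, (q i j : ℚ) * x j = y i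
  rel : ∀ i : S, γ (Sum.inl i) * γ (Sum.inr i) =
    ∏ j, γ (Sum.inl j) ^ (q i j).toNat + ∏ j, γ (Sum.inl j) ^ (-q i j).toNat
  gen : ∀ f : A, ∃ (D : ℤ) (N : ℕ) (G : MvPolynomial (V ⊕ S) ℤ), D ≠ 0 ∧
    (D : A) * (∏ k ∈ Sᶜ, γ (Sum.inl k)) ^ N * f = MvPolynomial.eval₂Hom (Int.castRingHom _) γ G
  pts : ∀ z : V → Kˣ, ∃ p : A →+* K, ∀ v, p (γ (Sum.inl v)) = z v

section Gen

variable {V : Type*} [Fintype V] [DecidableEq V] {F : Type*} [Field F] [Algebra ℚ F]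

/-- The ring generated over `ℚ` by a family of units, some of their inverses, and further
elements. -/
def fractionAlgebra (S : Finset V) (γ : V ⊕ S → F) : Subalgebra ℚ F where
  carrier := {f | ∃ (D : ℤ) (N : ℕ) (G : MvPolynomial (V ⊕ S) ℤ), D ≠ 0 ∧
    (D : F) * (∏ k ∈ Sᶜ, γ (Sum.inl k)) ^ N * f = MvPolynomial.eval₂Hom (Int.castRingHom _) γ G}
  mul_mem' := by
    rintro f g ⟨D, N, G, hD, h⟩ ⟨D', N', G', hD', h'⟩
    refine ⟨D * D', N + N', G * G', mul_ne_zero hD hD', ?_⟩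
    rw [map_mul, ← h, ← h']
    push_cast
    ring
  add_mem' := by
    rintro f g ⟨D, N, G, hD, h⟩ ⟨D', N', G', hD', h'⟩
    have hpi : MvPolynomial.eval₂Hom (Int.castRingHom _) γ (∏ k ∈ Sᶜ, MvPolynomial.X (R := ℤ) (Sum.inl k : V ⊕ S)) =
      ∏ k ∈ Sᶜ, γ (Sum.inl k) := by simp
    refine ⟨D * D', N + N', MvPolynomial.C D' * (∏ k ∈ Sᶜ, MvPolynomial.X (Sum.inl k)) ^ N' * G +
      MvPolynomial.C D * (∏ k ∈ Sᶜ, MvPolynomial.X (Sum.inl k)) ^ N * G', mul_ne_zero hD hD', ?_⟩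
    rw [map_add, map_mul, map_mul, map_mul, map_mul, map_pow, map_pow, hpi, ← h, ← h',
      MvPolynomial.eval₂Hom_C, MvPolynomial.eval₂Hom_C]
    simp only [eq_intCast]
    push_cast
    ring
  algebraMap_mem' r := by
    refine ⟨r.den, 0, MvPolynomial.C r.num, by simp, ?_⟩
    have := congrArg (algebraMap ℚ F) (Rat.den_mul_eq_num r)
    rw [map_mul, map_natCast, map_intCast] at this
    rw [MvPolynomial.eval₂Hom_C, pow_zero, mul_one, eq_intCast, Int.cast_natCast, this]

theorem apply_mem_fractionAlgebra (S : Finset V) (γ : V ⊕ S → F) (x : V ⊕ S) :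
    γ x ∈ fractionAlgebra S γ :=
  ⟨1, 0, MvPolynomial.X x, one_ne_zero, by simp⟩

theorem inv_mem_fractionAlgebra (S : Finset V) (γ : V ⊕ S → F) {v : V} (hv : v ∉ S)
    (h : γ (Sum.inl v) ≠ 0) : (γ (Sum.inl v))⁻¹ ∈ fractionAlgebra S γ := by
  refine ⟨1, 1, ∏ k ∈ Sᶜ.erase v, MvPolynomial.X (Sum.inl k), one_ne_zero, ?_⟩
  rw [← Finset.mul_prod_erase Sᶜ _ (Finset.mem_compl.2 hv)]
  simp only [map_prod, MvPolynomial.eval₂Hom_X', Int.cast_one, one_mul, pow_one]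
  field_simp

end Gen

variable {V : Type*} [Fintype V] [DecidableEq V]

namespace Seed

theorem mutEquiv_freeze {t u : Seed V} {T : Finset V} (h : (t.freeze T).MutEquiv u) :
    ∃ u', t.MutEquiv u' ∧ u = u'.freeze T := by
  induction h with
  | refl => exact ⟨t, Relation.ReflTransGen.refl, rfl⟩
  | tail _ h ih =>
    obtain ⟨k, hk, rfl⟩ := h
    obtain ⟨u', hu', rfl⟩ := ih
    exact ⟨u'.mutate k, hu'.tail ⟨k, fun h => hk (Finset.mem_union_left _ h), rfl⟩, rfl⟩

/-- Generation is `leval_mem_of_exchange`, with coprimality from full rank. Torus points exist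
because `A` embeds into the Laurent ring of `u`, which can be evaluated at arbitrary nonzero values.
-/
theorem localModel_of_mutEquiv {s u : Seed V} (h : s.MutEquiv u) (hs : ∃ a, s.IsCluster a)
    (hr : s.quiver.FullRank) (K : Type*) [Field K] [CharZero K] {S : Finset V}
    (hS : ∀ i ∈ S, i ∉ u.quiver.frozen) (hS' : ∀ i ∈ S, ∀ j ∈ S, u.quiver.mat i j = 0) :
    LocalModel K S u.quiver.mat (Sum.elim
      (fun v => (⟨u.cluster v, cluster_mem_clusterAlgebra h v⟩ : s.clusterAlgebra))
      (fun i : S => ⟨(u.mutate i).cluster i,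
        cluster_mem_clusterAlgebra (h.tail ⟨i, hS i i.2, rfl⟩) i⟩)) := by
  obtain ⟨⟨a, ha⟩, hr'⟩ := h.exists_isCluster hs hr
  choose c hc using fun k => exists_exchange ha.2 (u.quiver.mat k) k
  have hcu : ∀ k, (c k : RatFun V) = (u.mutate k).cluster k := fun k => by
    rw [← (ha.mutate (hc k)).1, Function.update_self]
  set γ' : V ⊕ S → RatFun V := Sum.elim (fun v => a v) (fun i => c i) with hγ'
  refine ⟨hS', fun y => ?_, fun i => Subtype.ext ?_, fun f => ?_, fun z => ?_⟩
  · obtain ⟨x, hx⟩ := hr'.exists_rat y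
    exact ⟨x, fun i hi => hx i (hS i hi)⟩
  · have h1 := hc i
    have h2 : ∀ q : V → ℤ, ∏ j with 0 < q j, (a j : RatFun V) ^ (q j).toNat =
        ∏ j, (a j : RatFun V) ^ (q j).toNat := fun q => by
      rw [Finset.prod_filter]
      refine Finset.prod_congr rfl fun j _ => ?_
      split_ifs with h
      · rfl
      · rw [Int.toNat_of_nonpos (not_lt.1 h), pow_zero]
    have h3 := h2 (-u.quiver.mat i)
    simp only [Pi.neg_apply, Left.neg_pos_iff] at h3
    rw [leval_exch, lmono_posPart, lmono_negPart, h2, h3, mul_comm] at h1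
    simp only [hcu, ha.1] at h1
    simpa using h1
  · have hf := inUpperBound_of_mem_clusterAlgebra h hs hr f.2 a ha
    have key : (f : RatFun V) ∈ fractionAlgebra S γ' := by
      refine leval_mem_of_exchange ha.2 (fun k _ => hc k)
        (fun k hk => exch_mem_restrictDeg fun j hj => hS' k hk j hj)
        (fun k _ => exch_mem_coordDeg (u.quiver.mat_self k)) (fun k hk l hl hkl => ?_) hf.1
        (fun k hk => hf.2 k (hS k hk) _ (hc k))
        (fun v => apply_mem_fractionAlgebra S γ' (Sum.inl v))
        (fun v hv => inv_mem_fractionAlgebra S γ' hv (Units.ne_zero _))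
        (fun k hk => apply_mem_fractionAlgebra S γ' (Sum.inr ⟨k, hk⟩))
      obtain ⟨x, hx, hx'⟩ := hr'.exists_int (hS k hk)
      exact regMod_exch (hx' l (hS l hl) hkl.symm) hx
    obtain ⟨D, N, G, hD, hG⟩ := key
    refine ⟨D, N, G, hD, Subtype.coe_injective ?_⟩
    have h1 := MvPolynomial.map_eval₂Hom (Int.castRingHom _) (Sum.elim
      (fun v => (⟨u.cluster v, cluster_mem_clusterAlgebra h v⟩ : s.clusterAlgebra))
      (fun i : S => ⟨(u.mutate i).cluster i,
        cluster_mem_clusterAlgebra (h.tail ⟨i, hS i i.2, rfl⟩) i⟩)) s.clusterAlgebra.subtype G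
    have h2 : (fun x => s.clusterAlgebra.subtype (Sum.elim
      (fun v => (⟨u.cluster v, cluster_mem_clusterAlgebra h v⟩ : s.clusterAlgebra))
      (fun i : S => ⟨(u.mutate i).cluster i,
        cluster_mem_clusterAlgebra (h.tail ⟨i, hS i i.2, rfl⟩) i⟩) x)) = γ' := by
      ext (v | i)
      · exact (ha.1 v).symm
      · exact (hcu i).symm
    rw [h2, RingHom.ext_int (s.clusterAlgebra.subtype.comp (Int.castRingHom _))
      (Int.castRingHom _), ← hG] at h1
    refine Eq.trans ?_ h1.symm
    simp [hγ', ha.1]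
  · have hle : ∀ f ∈ s.clusterAlgebra, f ∈ laur a := fun f hf =>
      (inUpperBound_of_mem_clusterAlgebra h hs hr hf a ha).1
    let e : LaurentRing V ≃ₐ[ℚ] laur a := AlgEquiv.ofInjective (leval a) ha.2
    let φ : s.clusterAlgebra →+* laur a := s.clusterAlgebra.subtype.codRestrict (laur a)
      fun f => hle f f.2
    refine ⟨((leval z : LaurentRing V →ₐ[ℚ] K) : LaurentRing V →+* K).comp
      (e.symm.toRingEquiv.toRingHom.comp φ), fun v => ?_⟩
    have h1 : e.symm (φ ⟨u.cluster v, cluster_mem_clusterAlgebra h v⟩) =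
        mon (Pi.single v 1) := by
      rw [AlgEquiv.symm_apply_eq]
      refine Subtype.ext ?_
      change u.cluster v = leval a _
      rw [leval_mon, lmono_single, zpow_one, ha.1]
    change leval z (e.symm (φ ⟨u.cluster v, cluster_mem_clusterAlgebra h v⟩)) = z v
    rw [h1, leval_mon, lmono_single, zpow_one]

end Seed

omit [DecidableEq V] in
-- An arrow inside `S` would allow walking backwards inside `S` forever, in a finite acyclic quiver.
theorem IceQuiver.IsAcyclic.mat_eq_zero {Q : IceQuiver V} (hQ : Q.IsAcyclic) {S : Finset V}
    (hS : ∀ i ∈ S, i ∉ Q.frozen)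
    (h : ∀ i ∈ S, (∃ j ∈ S, 0 < Q.mat i j) → ∃ j ∈ S, 0 < Q.mat j i) :
    ∀ i ∈ S, ∀ j ∈ S, Q.mat i j = 0 := by
  have hno : ∀ i ∈ S, ¬ ∃ j ∈ S, 0 < Q.mat i j := by
    have : Std.Irrefl (Relation.TransGen Q.MutArrow) := ⟨hQ⟩
    have wf : WellFounded (Relation.TransGen Q.MutArrow) :=
      Finite.wellFounded_of_trans_of_irrefl _
    intro i
    induction i using wf.induction with
    | _ i ih =>
      intro hi hex
      obtain ⟨j, hj, hji⟩ := h i hi hex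
      exact ih j (Relation.TransGen.single ⟨hS j hj, hS i hi, hji⟩) hj ⟨i, hi, hji⟩
  intro i hi j hj
  have h1 := hno i hi
  have h2 := hno j hj
  push Not at h1 h2
  have := h1 j hj
  have := h2 i hi
  rw [Q.skew] at this
  omega

/-- An element that becomes a unit in a chart avoids all primes coming from that chart. It is
applied to the frozen variables of the chart. -/
theorem notMem_of_mem_range_comap {F : Type*} [Field F] {A B : Subring F} (hle : A ≤ B)
    {P : PrimeSpectrum A} (hP : P ∈ Set.range (PrimeSpectrum.comap (Subring.inclusion hle)))
    {x : A} (hx : (x : F) ≠ 0) (hx' : (x : F)⁻¹ ∈ B) : x ∉ P.asIdeal := by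
  obtain ⟨P', rfl⟩ := hP
  intro h
  refine P'.2.ne_top ((Ideal.eq_top_iff_one _).2 ?_)
  have h3 := P'.asIdeal.mul_mem_right ⟨_, hx'⟩ h
  convert h3
  exact Subtype.ext (mul_inv_cancel₀ hx).symm

theorem Seed.exists_localModel {s : Seed V} (hs : ∃ a, s.IsCluster a) (hr : s.quiver.FullRank)
    (hloc : s.IsLocallyAcyclic) {K : Type*} [Field K] [CharZero K]
    (p : s.clusterAlgebra →+* K) :
    ∃ (S : Finset V) (q : V → V → ℤ) (γ : V ⊕ S → s.clusterAlgebra), LocalModel K S q γ ∧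
      ∀ v, p (γ (Sum.inl v)) = 0 ↔ v ∈ S := by
  classical
  obtain ⟨C, -, hC, hcov⟩ := hloc
  obtain ⟨s', hs'C, hle, hP⟩ := hcov ⟨RingHom.ker p, RingHom.ker_isPrime p⟩
  obtain ⟨⟨⟨t, T, hst, rfl⟩, -⟩, u, hu, hac⟩ := hC s' hs'C
  obtain ⟨u, htu, rfl⟩ := mutEquiv_freeze hu
  have hsu : s.MutEquiv u := hst.trans htu
  obtain ⟨⟨a, ha⟩, -⟩ := hst.exists_isCluster hs hr
  have hfrozen : ∀ v ∈ u.quiver.frozen ∪ T,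
      p ⟨u.cluster v, cluster_mem_clusterAlgebra hsu v⟩ ≠ 0 := by
    intro v hv h0
    have hv' : v ∈ (t.freeze T).quiver.frozen := by
      rwa [htu.frozen_eq] at hv
    have hcl : u.cluster v = t.cluster v := hu.cluster_eq hv'
    refine notMem_of_mem_range_comap hle hP ?_ ?_ h0
    · change u.cluster v ≠ 0
      rw [hcl, ← ha.1]; exact Units.ne_zero _
    · change (u.cluster v)⁻¹ ∈ _
      rw [hcl]; exact Subring.subset_closure (Or.inr ⟨v, hv', rfl⟩)
  set S : Finset V := Finset.univ.filter fun v =>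
    p ⟨u.cluster v, cluster_mem_clusterAlgebra hsu v⟩ = 0 with hSdef
  have hmem : ∀ v, v ∈ S ↔ p ⟨u.cluster v, cluster_mem_clusterAlgebra hsu v⟩ = 0 := by
    simp [hSdef]
  have hS : ∀ i ∈ S, i ∉ (u.freeze T).quiver.frozen := fun i hi hi' =>
    hfrozen i hi' ((hmem i).1 hi)
  have hS0 : ∀ i ∈ S, i ∉ u.quiver.frozen := fun i hi hi' =>
    hS i hi (Finset.mem_union_left _ hi')
  have hS' : ∀ i ∈ S, ∀ j ∈ S, u.quiver.mat i j = 0 := by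
    refine hac.mat_eq_zero hS ?_
    rintro i hi ⟨j, hj, hij⟩
    change 0 < u.quiver.mat i j at hij
    change ∃ j ∈ S, 0 < u.quiver.mat j i
    by_contra hno
    push Not at hno
    -- The local model of the single vertex `i` serves only to provide its exchange relation.
    have hlm := localModel_of_mutEquiv hsu hs hr K (S := {i})
      (by simpa using hS0 i hi) (by simp [u.quiver.mat_self])
    have h1 := congrArg p (hlm.rel ⟨i, by simp⟩)
    simp only [Sum.elim_inl, Sum.elim_inr, map_mul, map_add, map_prod, map_pow] at h1
    -- The left side vanishes at `p`, as does the outgoing product because of `j`. Hence the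
    -- incoming product vanishes, which yields an arrow into `i` from some `l ∈ S`.
    rw [(hmem i).1 hi, zero_mul, Finset.prod_eq_zero (Finset.mem_univ j) (by
      rw [(hmem j).1 hj, zero_pow]; simpa using hij), zero_add, eq_comm,
      Finset.prod_eq_zero_iff] at h1
    obtain ⟨l, -, hl⟩ := h1
    rw [pow_eq_zero_iff', ← hmem] at hl
    have h2 := hno l hl.1
    rw [u.quiver.skew] at h2
    apply hl.2
    simp only [Int.toNat_eq_zero]
    exact h2
  refine ⟨S, _, _, localModel_of_mutEquiv hsu hs hr K hS0 hS', fun v => ?_⟩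
  rw [Sum.elim_inl]
  exact (hmem v).symm

end

/-! ### The Jacobian of the exchange relations. -/

section

open Filter Topology

section Monomial

variable {V : Type*} [Fintype V] {K : Type*} [RCLike K]

/-- Along the logarithmic direction `δ j = z j * x j` a monomial is multiplied by a linear form in
`x`. Only the variables that occur need to move in this way. -/
theorem hasDerivAt_prod_pow (z x δ : V → K) (n : V → ℕ) (h : ∀ j, n j ≠ 0 → δ j = z j * x j) :
    HasDerivAt (fun t : K => ∏ j, (z j + t * δ j) ^ n j)
      ((∏ j, z j ^ n j) * ∑ j, (n j : K) * x j) 0 := by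
  classical
  have h1 : ∀ j, HasDerivAt (fun t : K => (z j + t * δ j) ^ n j)
      (z j ^ n j * ((n j : K) * x j)) 0 := fun j => by
    have h2 : HasDerivAt (fun t : K => z j + t * δ j) (δ j) 0 := by
      simpa using ((hasDerivAt_id (0 : K)).mul_const (δ j)).const_add (z j)
    convert! h2.pow (n j) using 1
    rcases Nat.eq_zero_or_pos (n j) with h0 | h0
    · simp [h0]
    · obtain ⟨m, hm⟩ := Nat.exists_eq_succ_of_ne_zero h0.ne'
      rw [h j h0.ne', hm]
      simp
      ring
  convert! HasDerivAt.fun_finsetProd (u := Finset.univ) fun j _ => h1 j using 1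
  rw [Finset.mul_sum]
  refine Finset.sum_congr rfl fun j hj => ?_
  rw [← Finset.mul_prod_erase _ _ hj, smul_eq_mul]
  simp only [zero_mul, add_zero]
  ring

end Monomial

section Exchange

variable {V : Type*} [Fintype V] [DecidableEq V] {K : Type*} [RCLike K] {S : Finset V}

/-- The map whose zeros are the solutions of the exchange relations. -/
def exchangeMap (K : Type*) [RCLike K] (S : Finset V) (q : V → V → ℤ) (z : V ⊕ S → K) : S → K :=
  fun i => z (Sum.inl i) * z (Sum.inr i) -
    (∏ j, z (Sum.inl j) ^ (q i j).toNat + ∏ j, z (Sum.inl j) ^ (-q i j).toNat)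

omit [DecidableEq V] in
theorem contDiff_exchangeMap (q : V → V → ℤ) : ContDiff K ω (exchangeMap K S q) := by
  unfold exchangeMap
  refine contDiff_pi.2 fun i => ?_
  refine ContDiff.sub (by fun_prop) (ContDiff.add ?_ ?_) <;>
  exact contDiff_prod fun j _ => by fun_prop

/-- Surjectivity passes from `ℚ` to `K` by combining preimages of basis vectors. -/
theorem LocalModel.exists_rank {A : Type*} [CommRing A] {q : V → V → ℤ} {γ : V ⊕ S → A}
    (h : LocalModel K S q γ) (y : S → K) :
    ∃ x : V → K, ∀ i : S, ∑ j, (q i j : K) * x j = y i := by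
  choose x hx using fun i : S => h.rank (Pi.single i.1 1)
  refine ⟨fun j => ∑ i, y i * (x i j : K), fun l => ?_⟩
  have h1 : ∀ i, ∑ j, (q l j : K) * (x i j : K) = if l = i then 1 else 0 := fun i => by
    have := congrArg (fun r : ℚ => (r : K)) (hx i l l.2)
    simp only [Rat.cast_sum, Rat.cast_mul, Rat.cast_intCast] at this
    rw [this]
    by_cases hl : l = i
    · simp [hl]
    · rw [Pi.single_eq_of_ne (fun e => hl (Subtype.ext e))]
      simp [hl]
  simp only [Finset.mul_sum]
  rw [Finset.sum_comm]
  have h2 : ∀ i, ∑ j, (q l j : K) * (y i * (x i j : K)) = y i * if l = i then 1 else 0 :=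
    fun i => by
      rw [← h1 i, Finset.mul_sum]
      exact Finset.sum_congr rfl fun j _ => by ring
  simp [h2]

/-- At a solution of the exchange relations, the differentials of the exchange relations and of the
coordinates that vanish there are linearly independent. -/
theorem LocalModel.fderiv_surjective {A : Type*} [CommRing A] {q : V → V → ℤ} {γ : V ⊕ S → A}
    (h : LocalModel K S q γ) {z : V ⊕ S → K} (hz : exchangeMap K S q z = 0)
    (hz' : ∀ k ∉ S, z (Sum.inl k) ≠ 0) (y e : S → K) :
    ∃ δ : V ⊕ S → K, fderiv K (exchangeMap K S q) z δ = y ∧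
      ∀ i : S, z (Sum.inl i) = 0 → δ (Sum.inl i) = e i := by
  have hM : ∀ (i : S) (n : V → ℕ), (∀ j ∈ S, n j = 0) → ∏ j, z (Sum.inl j) ^ n j ≠ 0 := by
    intro i n hn
    refine Finset.prod_ne_zero_iff.2 fun j _ => ?_
    by_cases hj : j ∈ S
    · simp [hn j hj]
    · exact pow_ne_zero _ (hz' j hj)
  have hp : ∀ i : S, ∏ j, z (Sum.inl j) ^ (q i j).toNat ≠ 0 := fun i =>
    hM i _ fun j hj => by simp [h.eq_zero i i.2 j hj]
  set Mp : S → K := fun i => ∏ j, z (Sum.inl j) ^ (q i j).toNat with hMp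
  set Mn : S → K := fun i => ∏ j, z (Sum.inl j) ^ (-q i j).toNat with hMn
  -- Where `z (inl i) = 0`, the relation gives `Mn i = -Mp i`, so the derivative of relation `i` is
  -- `e i * z (inr i) - Mp i * ∑ j, q i j * x j`. This choice of `x` makes it `y i`.
  obtain ⟨x, hx⟩ := h.exists_rank fun i : S => (e i * z (Sum.inr i) - y i) / Mp i
  set P : S → K := fun i => Mp i * ∑ j, ((q i j).toNat : K) * x j +
    Mn i * ∑ j, ((-q i j).toNat : K) * x j with hP
  -- Off `S` the direction is logarithmic. In `S`, the relations with `z (inl i) ≠ 0` are solved by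
  -- moving the adjacent variable.
  set δ : V ⊕ S → K := Sum.elim
    (fun v => if hv : v ∈ S then (if z (Sum.inl v) = 0 then e ⟨v, hv⟩ else 0)
      else z (Sum.inl v) * x v)
    (fun i => if z (Sum.inl i) = 0 then 0 else (y i + P i) / z (Sum.inl i)) with hδ
  refine ⟨δ, ?_, fun i hi => by simp [hδ, hi]⟩
  have hd : HasDerivAt (fun t : K => exchangeMap K S q (z + t • δ))
      (fderiv K (exchangeMap K S q) z δ) 0 :=
    (((contDiff_exchangeMap q).differentiable (by simp)) z).hasFDerivAt.hasLineDerivAt δ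
  ext i
  have hdi := hasDerivAt_pi.1 hd i
  refine hdi.unique ?_
  have hlin : ∀ w : V ⊕ S, HasDerivAt (fun t : K => z w + t * δ w) (δ w) 0 := fun w => by
    simpa using ((hasDerivAt_id (0 : K)).mul_const (δ w)).const_add (z w)
  have hmon : ∀ n : V → ℕ, (∀ j ∈ S, n j = 0) →
      HasDerivAt (fun t : K => ∏ j, (z (Sum.inl j) + t * δ (Sum.inl j)) ^ n j)
        ((∏ j, z (Sum.inl j) ^ n j) * ∑ j, (n j : K) * x j) 0 := fun n hn =>
    hasDerivAt_prod_pow (fun j => z (Sum.inl j)) x (fun j => δ (Sum.inl j)) n fun j hj => by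
      have : j ∉ S := fun hj' => hj (hn j hj')
      simp [hδ, this]
  have hval : y i = (δ (Sum.inl i) * (z (Sum.inr i) + 0 * δ (Sum.inr i)) +
      (z (Sum.inl i) + 0 * δ (Sum.inl i)) * δ (Sum.inr i)) - P i := by
    by_cases hi : z (Sum.inl i) = 0
    · have hzi := congrFun hz i
      simp only [exchangeMap, hi, zero_mul, zero_sub, Pi.zero_apply, neg_eq_zero] at hzi
      have hMn' : Mn i = -Mp i := by rw [eq_neg_iff_add_eq_zero, add_comm]; exact hzi
      have hPi : P i = Mp i * ∑ j, (q i j : K) * x j := by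
        rw [hP]
        simp only
        rw [hMn', neg_mul, ← sub_eq_add_neg, ← mul_sub, ← Finset.sum_sub_distrib]
        congr 1
        refine Finset.sum_congr rfl fun j _ => ?_
        rw [← sub_mul]
        congr 1
        have : (q i j) = ((q i j).toNat : ℤ) - ((-q i j).toNat : ℤ) := by omega
        conv_rhs => rw [this]
        push_cast
        rfl
      rw [hPi, hx i, mul_div_cancel₀ _ (hp i)]
      simp [hδ, hi]
    · simp [hδ, hi]
      field_simp
      ring
  rw [hval]
  refine HasDerivAt.sub ((hlin (Sum.inl i)).mul (hlin (Sum.inr i))) (HasDerivAt.add ?_ ?_)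
  · exact hmon _ fun j hj => by simp [h.eq_zero i i.2 j hj]
  · exact hmon _ fun j hj => by simp [h.eq_zero i i.2 j hj]

end Exchange

end

/-! ### Points as solutions of the exchange relations. -/

section

open Filter Topology

section Points

variable {V : Type*} [Fintype V] [DecidableEq V] {K : Type*} [RCLike K] {S : Finset V}
  {A : Type*} [CommRing A] {q : V → V → ℤ} {γ : V ⊕ S → A}

theorem LocalModel.exchangeMap_eq_zero (h : LocalModel K S q γ) (p : A →+* K) :
    exchangeMap K S q (fun x => p (γ x)) = 0 := by
  ext i
  have := congrArg p (h.rel i)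
  simp only [map_mul, map_add, map_prod, map_pow] at this
  simp [exchangeMap, this]

/-- The relation at `i` determines the adjacent coordinate once `z (inl i) ≠ 0`, so a torus point
with the right cluster values suffices. -/
theorem LocalModel.exists_of_forall_ne_zero (h : LocalModel K S q γ) {z : V ⊕ S → K}
    (hz : exchangeMap K S q z = 0) (hz' : ∀ v, z (Sum.inl v) ≠ 0) :
    ∃ p : A →+* K, (fun x => p (γ x)) = z := by
  obtain ⟨p, hp⟩ := h.pts fun v => Units.mk0 _ (hz' v)
  refine ⟨p, funext ?_⟩
  rintro (v | i)
  · exact hp v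
  · have h1 := congrFun (h.exchangeMap_eq_zero p) i
    have h2 := congrFun hz i
    simp only [exchangeMap, hp, Units.val_mk0, Pi.zero_apply, sub_eq_zero] at h1 h2
    exact mul_left_cancel₀ (hz' i) (h1.trans h2.symm)

/-- The exchange relations and the coordinates `inl i` vanishing at `z` together form a submersion
at `z`, hence a map open at `z`. So arbitrarily near `z` there are solutions where these coordinates
equal some `ε ≠ 0`, and such solutions come from torus points. -/
theorem LocalModel.mem_closure_range (h : LocalModel K S q γ) {z : V ⊕ S → K}
    (hz : exchangeMap K S q z = 0) (hz' : ∀ k ∉ S, z (Sum.inl k) ≠ 0) :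
    z ∈ closure (Set.range fun (p : A →+* K) (x : V ⊕ S) => p (γ x)) := by
  let L : (V ⊕ S → K) →L[K] ({i : S // z (Sum.inl i) = 0} → K) :=
    ContinuousLinearMap.pi fun i => ContinuousLinearMap.proj (Sum.inl i.1.1)
  have hΦ : HasStrictFDerivAt (exchangeMap K S q) (fderiv K (exchangeMap K S q) z) z :=
    (contDiff_exchangeMap q).contDiffAt.hasStrictFDerivAt (by simp)
  have hΨ := hΦ.prodMk (L.hasStrictFDerivAt (x := z))
  have hsurj : ((fderiv K (exchangeMap K S q) z).prod L).range = ⊤ := by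
    rw [LinearMap.range_eq_top]
    rintro ⟨y, e⟩
    obtain ⟨δ, hδ, hδ'⟩ := h.fderiv_surjective hz hz' y
      fun i => if hi : z (Sum.inl i) = 0 then e ⟨i, hi⟩ else 0
    refine ⟨δ, Prod.ext hδ (funext fun i => ?_)⟩
    change δ (Sum.inl i.1.1) = e i
    rw [hδ' i.1 i.2, dif_pos i.2]
  have hmap := hΨ.map_nhds_eq_of_surj hsurj
  rw [mem_closure_iff_nhds]
  intro N hN
  have hne : ∀ᶠ w in 𝓝 z, ∀ v, z (Sum.inl v) ≠ 0 → w (Sum.inl v) ≠ 0 := by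
    refine Filter.eventually_all.2 fun v => ?_
    by_cases hv : z (Sum.inl v) = 0
    · simp [hv]
    · have hc : ContinuousAt (fun w : V ⊕ S → K => w (Sum.inl v)) z :=
        (continuous_apply _).continuousAt
      filter_upwards [hc.eventually_ne hv] with w hw _ using hw
  have himg := Filter.image_mem_map (m := fun w => (exchangeMap K S q w, L w))
    (Filter.inter_mem hN hne)
  rw [hmap] at himg
  have hz0 : (exchangeMap K S q z, L z) = ((0 : S → K), (fun _ => (0 : K))) := by
    refine Prod.ext hz (funext fun i => i.2)
  rw [hz0] at himg
  have hcont : Tendsto (fun ε : K => ((0 : S → K), fun _ : {i : S // z (Sum.inl i) = 0} => ε))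
      (𝓝[≠] 0) (𝓝 (0, fun _ => 0)) := by
    refine Tendsto.mono_left (Continuous.tendsto ?_ 0) nhdsWithin_le_nhds
    fun_prop
  obtain ⟨ε, ⟨w, ⟨hwN, hw⟩, hwε⟩, hε⟩ := ((hcont.eventually himg).and
    self_mem_nhdsWithin).exists
  obtain ⟨hw1, hw2⟩ := Prod.ext_iff.1 hwε
  obtain ⟨p, hp⟩ := h.exists_of_forall_ne_zero hw1 fun v => by
    by_cases hv : z (Sum.inl v) = 0
    · have hvS : v ∈ S := by_contra fun hvS => hz' v hvS hv
      have : w (Sum.inl v) = ε := congrFun hw2 ⟨⟨v, hvS⟩, hv⟩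
      rw [this]
      exact hε
    · exact hw v hv
  exact ⟨w, hwN, p, hp⟩

omit [DecidableEq V] in
theorem contDiff_eval₂Hom (G : MvPolynomial (V ⊕ S) ℤ) :
    ContDiff K ω fun z : V ⊕ S → K => MvPolynomial.eval₂Hom (Int.castRingHom K) z G := by
  induction G using MvPolynomial.induction_on with
  | C a => simpa using contDiff_const
  | add f g hf hg => simpa using hf.add hg
  | mul_X f x hf =>
    simp only [map_mul, MvPolynomial.eval₂Hom_X']
    exact hf.mul (contDiff_apply K K x)

/-- Where the generators `γ k`, `k ∉ S`, do not vanish, the value of an element of the ring at a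
point is an analytic function of the values of the generators. -/
theorem LocalModel.exists_formula (h : LocalModel K S q γ) (f : A) :
    ∃ g : (V ⊕ S → K) → K, ContDiffOn K ω g {z | ∀ k ∉ S, z (Sum.inl k) ≠ 0} ∧
      ∀ p : A →+* K, (∀ k ∉ S, p (γ (Sum.inl k)) ≠ 0) → p f = g fun x => p (γ x) := by
  obtain ⟨D, N, G, hD, hG⟩ := h.gen f
  have hne : ∀ z : V ⊕ S → K, (∀ k ∉ S, z (Sum.inl k) ≠ 0) →
      (D : K) * (∏ k ∈ Sᶜ, z (Sum.inl k)) ^ N ≠ 0 := fun z hz =>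
    mul_ne_zero (Int.cast_ne_zero.2 hD) (pow_ne_zero _ (Finset.prod_ne_zero_iff.2 fun k hk =>
      hz k (Finset.mem_compl.1 hk)))
  refine ⟨fun z => MvPolynomial.eval₂Hom (Int.castRingHom K) z G /
    ((D : K) * (∏ k ∈ Sᶜ, z (Sum.inl k)) ^ N), ?_, fun p hp => ?_⟩
  · refine (contDiff_eval₂Hom G).contDiffOn.div (ContDiff.contDiffOn ?_) hne
    exact contDiff_const.mul ((contDiff_prod fun k _ => contDiff_apply K K (Sum.inl k)).pow N)
  · refine (eq_div_iff (hne (fun x => p (γ x)) hp)).2 ?_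
    have h1 := congrArg p hG
    rw [MvPolynomial.map_eval₂Hom, RingHom.ext_int (p.comp (Int.castRingHom A))
      (Int.castRingHom K)] at h1
    rw [← h1]
    simp only [map_mul, map_intCast, map_pow, map_prod]
    ring

omit [DecidableEq V] in
theorem isOpen_forall_ne_zero :
    IsOpen {z : V ⊕ S → K | ∀ k ∉ S, z (Sum.inl k) ≠ 0} := by
  have : {z : V ⊕ S → K | ∀ k ∉ S, z (Sum.inl k) ≠ 0} =
      ⋂ k : {k // k ∉ S}, {z | z (Sum.inl k.1) ≠ 0} := by
    ext; simp
  rw [this]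
  exact isOpen_iInter_of_finite fun k => isOpen_ne_fun (continuous_apply _) continuous_const

/-- Every solution of the exchange relations comes from a point. -/
theorem LocalModel.exists_point (h : LocalModel K S q γ) {z : V ⊕ S → K}
    (hz : exchangeMap K S q z = 0) (hz' : ∀ k ∉ S, z (Sum.inl k) ≠ 0) :
    ∃ p : A →+* K, (fun x => p (γ x)) = z := by
  set ev : (A →+* K) → V ⊕ S → K := fun p x => p (γ x) with hev
  -- The points whose generators tend to `z` form a nontrivial filter. Each element of `A` converges
  -- along it, and the limits define a ring homomorphism.
  have hne : (comap ev (𝓝 z)).NeBot :=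
    comap_neBot_iff.2 fun t ht => by
      obtain ⟨_, hw, p, rfl⟩ := mem_closure_iff_nhds.1 (h.mem_closure_range hz hz') t ht
      exact ⟨p, hw⟩
  have hev_tendsto : Tendsto ev (comap ev (𝓝 z)) (𝓝 z) := tendsto_comap
  have hU : ∀ᶠ p in comap ev (𝓝 z), ∀ k ∉ S, p (γ (Sum.inl k)) ≠ 0 :=
    hev_tendsto.eventually (isOpen_forall_ne_zero.mem_nhds hz')
  choose g hg hg' using h.exists_formula
  have hlim : ∀ f, Tendsto (fun p : A →+* K => p f) (comap ev (𝓝 z)) (𝓝 (g f z)) := fun f => by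
    have hc : ContinuousAt (g f) z :=
      (hg f).continuousOn.continuousAt (isOpen_forall_ne_zero.mem_nhds hz')
    refine (hc.tendsto.comp hev_tendsto).congr' ?_
    filter_upwards [hU] with p hp using (hg' f p hp).symm
  let p : A →+* K :=
    { toFun := fun f => g f z
      map_one' := tendsto_nhds_unique (hlim 1) (by simp)
      map_mul' := fun x y => tendsto_nhds_unique (hlim (x * y)) (by
        simpa using (hlim x).mul (hlim y))
      map_zero' := tendsto_nhds_unique (hlim 0) (by simp)
      map_add' := fun x y => tendsto_nhds_unique (hlim (x + y)) (by
        simpa using (hlim x).add (hlim y)) }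
  refine ⟨p, funext fun x => tendsto_nhds_unique (hlim (γ x)) ?_⟩
  exact (tendsto_pi_nhds.1 hev_tendsto) x

theorem LocalModel.injOn (h : LocalModel K S q γ) {p p' : A →+* K}
    (hp : ∀ k ∉ S, p (γ (Sum.inl k)) ≠ 0) (he : (fun x => p (γ x)) = fun x => p' (γ x)) :
    p = p' := by
  ext f
  obtain ⟨g, -, hg⟩ := h.exists_formula f
  rw [hg p hp, hg p' (fun k hk => by rw [← congrFun he (Sum.inl k)]; exact hp k hk), he]

end Points

end

/-! ### Analytic charts from the implicit function theorem. -/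

section

open Filter Topology

section Straightening

/-- A map with surjective differential becomes a projection in suitable coordinates. -/
theorem exists_linear_complement {K E G M : Type*} [RCLike K] [NormedAddCommGroup E]
    [NormedSpace K E] [FiniteDimensional K E] [NormedAddCommGroup G] [NormedSpace K G]
    [FiniteDimensional K G] [NormedAddCommGroup M] [NormedSpace K M] [FiniteDimensional K M]
    (L : E →L[K] G) (hL : Function.Surjective L)
    (hdim : Module.finrank K E = Module.finrank K G + Module.finrank K M) :
    ∃ (π : E →L[K] M) (e : E ≃L[K] G × M), (e : E →L[K] G × M) = L.prod π := by
  have hker : Module.finrank K (LinearMap.ker (L : E →ₗ[K] G)) = Module.finrank K M := by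
    have h1 := LinearMap.finrank_range_add_finrank_ker (L : E →ₗ[K] G)
    rw [LinearMap.range_eq_top.2 hL, finrank_top] at h1
    omega
  obtain ⟨π₀, hπ₀⟩ := LinearMap.exists_leftInverse_of_injective
    (LinearMap.ker (L : E →ₗ[K] G)).subtype (by simp)
  let ψ := LinearEquiv.ofFinrankEq _ _ hker
  let π : E →ₗ[K] M := (ψ : _ →ₗ[K] M) ∘ₗ π₀
  have hinj : Function.Injective ((L : E →ₗ[K] G).prod π) := by
    rw [injective_iff_map_eq_zero]
    intro x hx
    obtain ⟨h1, h2⟩ := Prod.ext_iff.1 hx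
    have h3 : π₀ x = ⟨x, h1⟩ := LinearMap.congr_fun hπ₀ ⟨x, h1⟩
    have h4 : ψ (π₀ x) = 0 := h2
    rw [LinearEquiv.map_eq_zero_iff, h3] at h4
    exact congrArg Subtype.val h4
  let e := LinearMap.linearEquivOfInjective _ hinj (by rw [hdim, Module.finrank_prod])
  refine ⟨LinearMap.toContinuousLinearMap π, e.toContinuousLinearEquiv, ?_⟩
  ext x <;> rfl

end Straightening

section Chart

variable {K : Type*} [RCLike K] {A : Type*} [CommRing A]

theorem Points.isInducing_eval :
    IsInducing (fun (p : Points A K) (a : A) => Points.eval a p) := ⟨rfl⟩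

theorem Points.continuous_eval (a : A) : Continuous (Points.eval a : Points A K → K) :=
  (continuous_apply a).comp Points.isInducing_eval.continuous

/-- A chart of `Hom(A, K)` whose inverse is analytic, in the sense that all elements of `A` are
analytic functions of the coordinates, and whose coordinates are linear combinations of elements of
`A`. -/
def IsEvalChart {M : Type*} [NormedAddCommGroup M] [NormedSpace K M]
    (c : OpenPartialHomeomorph (Points A K) M) : Prop :=
  (∀ f : A, ContDiffOn K ω (fun m => Points.eval f (c.symm m)) c.target) ∧
    ∃ (N : ℕ) (γ : Fin N → A) (b : Fin N → M), ∀ p, c p = ∑ i, Points.eval (γ i) p • b i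

variable {V : Type*} [Fintype V] [DecidableEq V] {S : Finset V} {q : V → V → ℤ} {γ : V ⊕ S → A}

/-- A linear map `π` completes the exchange map to a local diffeomorphism at `z₀`. Points correspond
to the slice `Φ = 0`, of dimension `(|V| + |S|) - |S|`, with `π` as coordinates. -/
theorem LocalModel.exists_isEvalChart (h : LocalModel K S q γ) (p₀ : Points A K)
    (hp₀ : ∀ k ∉ S, Points.eval (γ (Sum.inl k)) p₀ ≠ 0) :
    ∃ c : OpenPartialHomeomorph (Points A K) (EuclideanSpace K V), p₀ ∈ c.source ∧
      IsEvalChart c := by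
  set ev : Points A K → V ⊕ S → K := fun p x => Points.eval (γ x) p with hev
  have hevc : Continuous ev := continuous_pi fun x => Points.continuous_eval _
  set Φ := exchangeMap K S q with hΦdef
  have hΦ : ContDiff K ω Φ := contDiff_exchangeMap q
  have hΦev : ∀ p, Φ (ev p) = 0 := fun p => h.exchangeMap_eq_zero p
  set Ω : Set (V ⊕ S → K) := {z | ∀ k ∉ S, z (Sum.inl k) ≠ 0} with hΩ
  have hΩo : IsOpen Ω := isOpen_forall_ne_zero
  set z₀ := ev p₀ with hz₀
  obtain ⟨π, e, he⟩ := exists_linear_complement (M := EuclideanSpace K V) (fderiv K Φ z₀)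
    (fun y => by
      obtain ⟨δ, hδ, -⟩ := h.fderiv_surjective (hΦev p₀) hp₀ y 0
      exact ⟨δ, hδ⟩) (by simp [add_comm])
  set Ψ : (V ⊕ S → K) → (S → K) × EuclideanSpace K V := fun z => (Φ z, π z) with hΨdef
  have hΨ : ContDiff K ω Ψ := hΦ.prodMk π.contDiff
  have hΨ' : HasFDerivAt Ψ (e : (V ⊕ S → K) →L[K] _) z₀ := by
    rw [he]
    exact ((hΦ.differentiable (by simp)) z₀).hasFDerivAt.prodMk π.hasFDerivAt
  set Θ := hΨ.contDiffAt.toOpenPartialHomeomorph Ψ hΨ' (n := ω) (by simp) with hΘ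
  have hΘc : ∀ z, Θ z = Ψ z := fun z => rfl
  have hz₀s : z₀ ∈ Θ.source :=
    hΨ.contDiffAt.mem_toOpenPartialHomeomorph_source hΨ' (by simp)
  have hsymm₀ : Θ.symm (Ψ z₀) = z₀ := Θ.left_inv hz₀s
  have hsm : ContDiffAt K ω Θ.symm (Ψ z₀) :=
    Θ.contDiffAt_symm (f₀' := e) (Θ.map_source hz₀s) (by rw [hsymm₀]; exact hΨ')
      (by rw [hsymm₀]; exact hΨ.contDiffAt)
  -- Analyticity of the inverse at one point spreads to a neighbourhood, so `W` can be shrunk to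
  -- stay in that region and over `Ω`.
  have hev1 : ∀ᶠ y in 𝓝 (Ψ z₀), ContDiffAt K ω Θ.symm y := hsm.eventually (by simp)
  have hev2 : ∀ᶠ y in 𝓝 (Ψ z₀), Θ.symm y ∈ Ω :=
    hsm.continuousAt.eventually (by rw [hsymm₀]; exact hΩo.mem_nhds hp₀)
  obtain ⟨W, hW, hWo, hW₀⟩ := mem_nhds_iff.1
    ((hev1.and hev2).and (Θ.open_target.mem_nhds (Θ.map_source hz₀s)))
  classical
  let lift : (V ⊕ S → K) → Points A K := fun z =>
    if hz : Φ z = 0 ∧ z ∈ Ω then (h.exists_point hz.1 hz.2).choose else p₀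
  have hlift : ∀ z, Φ z = 0 → z ∈ Ω → ev (lift z) = z := fun z h1 h2 => by
    have h3 : lift z = (h.exists_point h1 h2).choose := dif_pos ⟨h1, h2⟩
    rw [h3]
    exact (h.exists_point h1 h2).choose_spec
  have hsol : ∀ m : EuclideanSpace K V, ((0 : S → K), m) ∈ W →
      Φ (Θ.symm (0, m)) = 0 ∧ π (Θ.symm (0, m)) = m ∧ Θ.symm (0, m) ∈ Ω ∧
        ev (lift (Θ.symm (0, m))) = Θ.symm (0, m) := fun m hm => by
    have h1 : Ψ (Θ.symm (0, m)) = (0, m) := Θ.right_inv (hW hm).2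
    obtain ⟨h2, h3⟩ := Prod.ext_iff.1 h1
    exact ⟨h2, h3, (hW hm).1.2, hlift _ h2 (hW hm).1.2⟩
  choose g hg hg' using h.exists_formula
  have hinv : ∀ (f : A) (m : EuclideanSpace K V), ((0 : S → K), m) ∈ W →
      Points.eval f (lift (Θ.symm (0, m))) = g f (Θ.symm (0, m)) := fun f m hm => by
    obtain ⟨-, -, h3, h4⟩ := hsol m hm
    have h5 := hg' f (lift (Θ.symm (0, m))) fun k hk => by
      have := congrFun h4 (Sum.inl k)
      exact fun h0 => h3 k hk (this.symm.trans h0)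
    exact h5.trans (congrArg (g f) h4)
  have hsmooth : ∀ f : A, ContDiffOn K ω
      (fun m : EuclideanSpace K V => Points.eval f (lift (Θ.symm (0, m))))
      {m | ((0 : S → K), m) ∈ W} := fun f => by
    refine ContDiffOn.congr (f := fun m => g f (Θ.symm (0, m))) ?_ fun m hm => hinv f m hm
    intro m hm
    have h1 : ContDiffAt K ω (g f) (Θ.symm (0, m)) :=
      (hg f).contDiffAt (hΩo.mem_nhds (hsol m hm).2.2.1)
    have h2 : ContDiffAt K ω (fun m : EuclideanSpace K V => ((0 : S → K), m)) m :=
      contDiffAt_const.prodMk contDiffAt_id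
    exact (h1.comp m ((hW hm).1.1.comp m h2)).contDiffWithinAt
  have hΨev : ∀ p, Ψ (ev p) = (0, π (ev p)) := fun p => by rw [hΨdef]; simp [hΦev p]
  let c : OpenPartialHomeomorph (Points A K) (EuclideanSpace K V) :=
    { toFun := fun p => π (ev p)
      invFun := fun m => lift (Θ.symm (0, m))
      source := {p | ev p ∈ Θ.source ∧ Ψ (ev p) ∈ W}
      target := {m | ((0 : S → K), m) ∈ W}
      map_source' := fun p hp => by
        have := hp.2
        rwa [hΨev] at this
      map_target' := fun m hm => by
        obtain ⟨h1, h2, h3, h4⟩ := hsol m hm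
        refine ⟨?_, ?_⟩
        · rw [h4]; exact Θ.map_target (hW hm).2
        · rw [h4, hΨdef]
          simp only [h1, h2]
          exact hm
      left_inv' := fun p hp => by
        have h1 : Θ.symm (0, π (ev p)) = ev p := by
          rw [← hΨev]; exact Θ.left_inv hp.1
        have hpW : ((0 : S → K), π (ev p)) ∈ W := by rw [← hΨev]; exact hp.2
        obtain ⟨-, -, h3, h4⟩ := hsol _ hpW
        rw [h1] at h3 h4 ⊢
        exact (h.injOn (p := p) (p' := lift (ev p)) h3 h4.symm).symm
      right_inv' := fun m hm => by
        obtain ⟨h1, h2, h3, h4⟩ := hsol m hm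
        rw [h4, h2]
      open_source := (Θ.open_source.inter (hWo.preimage hΨ.continuous)).preimage hevc
      open_target := hWo.preimage (by fun_prop)
      continuousOn_toFun := (π.continuous.comp hevc).continuousOn
      -- In the topology of pointwise convergence this is continuity of each element of `A` in the
      -- coordinates.
      continuousOn_invFun := by
        rw [Points.isInducing_eval.continuousOn_iff]
        exact continuousOn_pi.2 fun f => (hsmooth f).continuousOn }
  refine ⟨c, ⟨hz₀s, hW₀⟩, hsmooth, Fintype.card (V ⊕ S),
    fun i => γ ((Fintype.equivFin (V ⊕ S)).symm i),
    fun i => π (Pi.single ((Fintype.equivFin (V ⊕ S)).symm i) 1), fun p => ?_⟩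
  change π (ev p) = _
  rw [Equiv.sum_comp (Fintype.equivFin (V ⊕ S)).symm
    fun x => Points.eval (γ x) p • π (Pi.single x 1)]
  conv_lhs => rw [pi_eq_sum_univ' (ev p)]
  rw [map_sum]
  refine Finset.sum_congr rfl fun x _ => ?_
  rw [map_smul]

end Chart

end

open Filter Topology

/-! ### From charts to the manifold structure. -/

section Manifold

variable {K : Type*} [RCLike K] {A : Type*} [CommRing A]

theorem Points.t2Space : T2Space (Points A K) := by
  refine T2Space.of_injective_continuous (f := fun (p : Points A K) (a : A) => Points.eval a p)
    (fun p q h => ?_) Points.isInducing_eval.continuous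
  exact RingHom.ext fun a => congrFun h a

theorem Points.secondCountableTopology [Countable A] : SecondCountableTopology (Points A K) :=
  Points.isInducing_eval.secondCountableTopology

/-- The coordinates of `c'` are linear combinations of elements of `A`, which are analytic in the
coordinates of `c`. -/
theorem IsEvalChart.contDiffOn_trans {M : Type*} [NormedAddCommGroup M] [NormedSpace K M]
    {c c' : OpenPartialHomeomorph (Points A K) M} (hc : IsEvalChart c) (hc' : IsEvalChart c') :
    ContDiffOn K ω (c.symm ≫ₕ c') (c.symm ≫ₕ c').source := by
  obtain ⟨N, γ, b, h⟩ := hc'.2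
  refine ContDiffOn.congr (f := fun m => ∑ i, Points.eval (γ i) (c.symm m) • b i) ?_
    fun m _ => h (c.symm m)
  refine ContDiffOn.sum fun i _ => ContDiffOn.smul ?_ contDiffOn_const
  exact (hc.1 (γ i)).mono fun m hm => hm.1

/-- In the chart the identity is `∑ f_i b_i` with `f_i ∈ A`, hence `v = ∑ df_i(v) b_i`. -/
theorem IsEvalChart.eq_zero_of_fderiv {M : Type*} [NormedAddCommGroup M] [NormedSpace K M]
    {c : OpenPartialHomeomorph (Points A K) M} (hc : IsEvalChart c) {m v : M} (hm : m ∈ c.target)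
    (hv : ∀ f : A, fderiv K (fun m => Points.eval f (c.symm m)) m v = 0) : v = 0 := by
  obtain ⟨N, γ, b, h⟩ := hc.2
  have hd : ∀ f, HasFDerivAt (fun m => Points.eval f (c.symm m))
      (fderiv K (fun m => Points.eval f (c.symm m)) m) m := fun f =>
    (((hc.1 f).contDiffAt (c.open_target.mem_nhds hm)).differentiableAt (by simp)).hasFDerivAt
  have h1 : HasFDerivAt (fun m => ∑ i, Points.eval (γ i) (c.symm m) • b i)
      (∑ i, (fderiv K (fun m => Points.eval (γ i) (c.symm m)) m).smulRight (b i)) m :=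
    HasFDerivAt.fun_sum fun i _ => (hd (γ i)).smul_const (b i)
  have h2 : HasFDerivAt (fun m => ∑ i, Points.eval (γ i) (c.symm m) • b i)
      (ContinuousLinearMap.id K M) m := by
    refine (hasFDerivAt_id m).congr_of_eventuallyEq ?_
    filter_upwards [c.open_target.mem_nhds hm] with x hx
    rw [← h, c.right_inv hx, id]
  have h3 := congrArg (fun L : M →L[K] M => L v) (h2.unique h1)
  simpa [hv] using h3

/-- Analytic charts whose coordinates are linear combinations of elements of `A` make `Hom(A, K)` a
manifold. -/
theorem pointsFormManifold_of_isEvalChart [Countable A] {ι : Type*} [Fintype ι]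
    {r : WithTop ℕ∞} (hr : r ≠ 0)
    (h : ∀ p : Points A K, ∃ c : OpenPartialHomeomorph (Points A K) (EuclideanSpace K ι),
      p ∈ c.source ∧ IsEvalChart c) : PointsFormManifold K r ι A := by
  choose c hc hc' using h
  refine ⟨Points.t2Space, Points.secondCountableTopology, ?_⟩
  let cs : ChartedSpace (EuclideanSpace K ι) (Points A K) :=
    { atlas := Set.range c
      chartAt := c
      mem_chart_source := hc
      chart_mem_atlas := fun p => ⟨p, rfl⟩ }
  have hman : IsManifold 𝓘(K, EuclideanSpace K ι) r (Points A K) := by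
    refine isManifold_of_contDiffOn _ _ _ ?_
    rintro _ _ ⟨p, rfl⟩ ⟨p', rfl⟩
    simpa using ((hc' p).contDiffOn_trans (hc' p')).of_le le_top
  have hext : ∀ p : Points A K,
      (extChartAt 𝓘(K, EuclideanSpace K ι) p p) ∈ (c p).target := fun p =>
    (c p).map_source (hc p)
  have hsm : ∀ a : A, ContMDiff 𝓘(K, EuclideanSpace K ι) 𝓘(K, K) r
      (Points.eval a : Points A K → K) := fun a p => by
    rw [contMDiffAt_iff]
    refine ⟨(Points.continuous_eval a).continuousAt, ?_⟩
    have h1 : ContDiffAt K r (fun m => Points.eval a ((c p).symm m))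
        (extChartAt 𝓘(K, EuclideanSpace K ι) p p) :=
      (((hc' p).1 a).contDiffAt ((c p).open_target.mem_nhds (hext p))).of_le le_top
    exact h1.contDiffWithinAt
  refine ⟨cs, hman, hsm, fun p v hv => ?_⟩
  refine (hc' p).eq_zero_of_fderiv (hext p) (v := v) fun a => ?_
  have h1 := hv a
  rw [((hsm a).mdifferentiable hr p).mfderiv, ModelWithCorners.range_eq_univ,
    fderivWithin_univ] at h1
  exact h1

end Manifold

/-- Makes the cluster algebra countable, so that `Hom(A, K)` has the topology induced from a
countable power of `K`. -/
instance countable_ratFun {V : Type*} [Finite V] : Countable (RatFun V) := by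
  have : Countable (MvPolynomial V ℚ) :=
    (AddMonoidAlgebra.coeff_injective (R := ℚ) (M := V →₀ ℕ)).countable
  refine Function.Surjective.countable (f := fun x : MvPolynomial V ℚ × MvPolynomial V ℚ =>
    algebraMap _ (RatFun V) x.1 / algebraMap _ (RatFun V) x.2) fun f => ?_
  obtain ⟨x, y, -, h⟩ := IsFractionRing.div_surjective (MvPolynomial V ℚ) f
  exact ⟨(x, y), h⟩

theorem Seed.pointsFormManifold {V : Type*} [Fintype V] [DecidableEq V] {s : Seed V}
    (hs : AlgebraicIndependent ℚ s.cluster) (hrank : s.quiver.FullRank)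
    (hloc : s.IsLocallyAcyclic) (K : Type*) [RCLike K] {r : WithTop ℕ∞} (hr : r ≠ 0) :
    PointsFormManifold K r V s.clusterAlgebra := by
  have hcl : ∃ a, s.IsCluster a :=
    ⟨fun v => Units.mk0 _ (hs.ne_zero v), fun v => rfl, leval_injective_of_algebraicIndependent hs⟩
  refine pointsFormManifold_of_isEvalChart hr fun p => ?_
  obtain ⟨S, q, γ, hγ, hp⟩ := Seed.exists_localModel (K := K) hcl hrank hloc p
  exact hγ.exists_isEvalChart p fun k hk h0 => hk ((hp k).1 h0)

end ClusterAlg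

theorem corollary7p6 {V : Type*} [Fintype V] [DecidableEq V] (s : ClusterAlg.Seed V)
    (hs : AlgebraicIndependent ℚ s.cluster)
    (hrank : s.quiver.FullRank) (hloc : s.IsLocallyAcyclic) :
    ClusterAlg.PointsFormManifold ℂ ω V s.clusterAlgebra ∧
      ClusterAlg.PointsFormManifold ℝ ∞ V s.clusterAlgebra :=
  ⟨ClusterAlg.Seed.pointsFormManifold hs hrank hloc ℂ (by simp),
    ClusterAlg.Seed.pointsFormManifold hs hrank hloc ℝ (by simp)⟩
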